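/- Let $\mathbb{D}=\{z\in\mathbb{C}:|z|<1\}$ and let $\Omega\subsetneq\mathbb{C}$ be a domain with $1\in\Omega$ which is starlike with respect to $1$. Let $\phi_\Omega$ be the unique conformal mapping of $\mathbb{D}$ onto $\Omega$ with $\phi_\Omega(0)=1$ and $\phi_\Omega'(0)>0$, and put $$k_\Omega(z)=\int_0^z\exp\left(\int_0^t\frac{\phi_\Omega(\zeta)-1}{\zeta}\,d\zeta\right)dt,\qquad z\in\mathbb{D}.$$ Let $\mathcal{C}(\Omega)$ be the set of analytic functions $f$ on $\mathbb{D}$ with $f(0)=0$, $f'(0)=1$ and $1+zf''(z)/f'(z)\in\Omega$ for all $z\in\mathbb{D}$ (in particular $f'$ has no zeros). For such $f$, as well as for $f=k_\Omega$, let $\log f'$ be the single-valued analytic branch on $\mathbb{D}$ with $\log f'(0)=0$, and let $\arg f'=\operatorname{Im}\log f'$. Then for every $f\in\mathcal{C}(\Omega)$ and every $r\in(0,1)$ the following hold. 1. $$\int_{-\pi}^{\pi}\log|\log f'(re^{i\theta})|\,d\theta\le\int_{-\pi}^{\pi}\log|\log k_\Omega'(re^{i\theta})|\,d\theta,$$ where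 $\log 0=-\infty$ and the left-hand side may be $-\infty$. Equality holds if and only if $f(z)=\overline{\varepsilon}\,k_\Omega(\varepsilon z)$ on $\mathbb{D}$ for some $\varepsilon$ with $|\varepsilon|=1$. 2. For every $0<p<\infty$, $$\int_{-\pi}^{\pi}|\log f'(re^{i\theta})|^p\,d\theta\le\int_{-\pi}^{\pi}|\log k_\Omega'(re^{i\theta})|^p\,d\theta,$$ with equality if and only if $f(z)=\overline{\varepsilon}\,k_\Omega(\varepsilon z)$ on $\mathbb{D}$ for some $\varepsilon$ with $|\varepsilon|=1$. 3. For every continuous convex function $\Phi:\mathbb{R}\to\mathbb{R}$ and each choice of the sign, $$\int_{-\pi}^{\pi}\Phi(\pm\log|f'(re^{i\theta})|)\,d\theta\le\int_{-\pi}^{\pi}\Phi(\pm\log|k_\Omega'(re^{i\theta})|)\,d\theta.$$ If $t\mapsto\Phi(\pm t)$ (same sign) is not linear, that is, not of the form $at+b$, on the interval $$\left(\min_{-\pi\le\theta\le\pi}\log|k_\Omega'(re^{i\theta})|,\ \max_{-\pi\le\theta\le\pi}\log|k_\Omega'(re^{i\theta})|\right),$$ then equality holds if and only if $f(z)=\overline{\varepsilon}\,k_\Omega(\varepsilon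 z)$ on $\mathbb{D}$ for some $\varepsilon$ with $|\varepsilon|=1$. 4. For every continuous convex function $\Phi:\mathbb{R}\to\mathbb{R}$ and each choice of the sign, $$\int_{-\pi}^{\pi}\Phi(\pm\arg f'(re^{i\theta}))\,d\theta\le\int_{-\pi}^{\pi}\Phi(\pm\arg k_\Omega'(re^{i\theta}))\,d\theta.$$ If $t\mapsto\Phi(\pm t)$ (same sign) is not linear, that is, not of the form $at+b$, on the interval $$\left(\min_{-\pi\le\theta\le\pi}\arg k_\Omega'(re^{i\theta}),\ \max_{-\pi\le\theta\le\pi}\arg k_\Omega'(re^{i\theta})\right),$$ then equality holds if and only if $f(z)=\overline{\varepsilon}\,k_\Omega(\varepsilon z)$ on $\mathbb{D}$ for some $\varepsilon$ with $|\varepsilon|=1$. -/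

import Mathlib

open MeasureTheory
open scoped ComplexConjugate

noncomputable section

namespace ConvexMeans

/-- The open unit disk. -/
def unitDisk : Set ℂ := Metric.ball 0 1

/-- The integral of `g` along the segment from `0` to `z`:
`∫₀ᶻ g(ζ) dζ = ∫₀¹ g(tz) z dt`. -/
def segIntegral (g : ℂ → ℂ) (z : ℂ) : ℂ := ∫ t in (0 : ℝ)..1, g ((t : ℂ) * z) * z

/-- `φ` is the conformal mapping of the unit disk onto `Ω`
normalized by `φ(0) = 1` and `φ'(0) > 0`. -/
structure IsNormalizedConformalMap (Ω : Set ℂ) (φ : ℂ → ℂ) : Prop where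
  holomorphic : DifferentiableOn ℂ φ unitDisk
  bijective : Set.BijOn φ unitDisk Ω
  map_zero : φ 0 = 1
  deriv_im : (deriv φ 0).im = 0
  deriv_pos : 0 < (deriv φ 0).re

/-- The function `k_Ω(z) = ∫₀ᶻ exp(∫₀ᵗ (φ_Ω(ζ) - 1)/ζ dζ) dt`. -/
def kFun (φ : ℂ → ℂ) : ℂ → ℂ :=
  segIntegral fun t => Complex.exp (segIntegral (fun ζ => (φ ζ - 1) / ζ) t)

/-- The class `C(Ω)`: analytic `f` on the unit disk with `f(0) = 0`, `f'(0) = 1` and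
`1 + z f''(z)/f'(z) ∈ Ω` on the disk (in particular the quotient is finite: a zero of `f'`
in the disk would be a pole of it). -/
structure MemC (Ω : Set ℂ) (f : ℂ → ℂ) : Prop where
  holomorphic : DifferentiableOn ℂ f unitDisk
  map_zero : f 0 = 0
  deriv_zero : deriv f 0 = 1
  deriv_ne_zero : ∀ z ∈ unitDisk, deriv f z ≠ 0
  mem : ∀ z ∈ unitDisk, 1 + z * deriv (deriv f) z / deriv f z ∈ Ω

/-- The single-valued branch of `log f'` on the unit disk with value `0` at `0`, that is
`∫₀ᶻ f''(ζ)/f'(ζ) dζ`; see `logDer_spec`. -/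
def logDer (f : ℂ → ℂ) : ℂ → ℂ :=
  segIntegral fun ζ => deriv (deriv f) ζ / deriv f ζ

/-- The branch `arg f' = Im log f'` of the argument, with `arg f'(0) = 0`. -/
def argDer (f : ℂ → ℂ) (z : ℂ) : ℝ := (logDer f z).im

/-- The integral over `[-π, π]` of an extended real valued function, as the integral of the
positive part minus the integral of the negative part; it may be `-∞`. -/
def erealMean (g : ℝ → EReal) : EReal :=
  ((∫⁻ θ in Set.Icc (-Real.pi) Real.pi, (g θ).toENNReal : ENNReal) : EReal)
    - ((∫⁻ θ in Set.Icc (-Real.pi) Real.pi, (-(g θ)).toENNReal : ENNReal) : EReal)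

/-- `∫_{-π}^{π} log |log f'(r e^{iθ})| dθ ∈ [-∞, ∞)`, where `log 0 = -∞`. -/
def logLogMean (f : ℂ → ℂ) (r : ℝ) : EReal :=
  erealMean fun θ => ENNReal.log ‖logDer f (circleMap 0 r θ)‖ₑ

/-- `f(z) = conj(ε) k(ε z)` on the unit disk for some `ε` on the unit circle. -/
def IsRotationOf (k f : ℂ → ℂ) : Prop :=
  ∃ ε : ℂ, ‖ε‖ = 1 ∧ ∀ z ∈ unitDisk, f z = conj ε * k (ε * z)

/-- The open interval between the minimum and the maximum of `h` over the circle `|z| = r`. -/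
def circleRange (h : ℂ → ℝ) (r : ℝ) : Set ℝ :=
  Set.Ioo (sInf ((fun θ : ℝ => h (circleMap 0 r θ)) '' Set.Icc (-Real.pi) Real.pi))
    (sSup ((fun θ : ℝ => h (circleMap 0 r θ)) '' Set.Icc (-Real.pi) Real.pi))

/-- `Ψ` is linear (affine) on `I`. -/
def IsLinearOn (Ψ : ℝ → ℝ) (I : Set ℝ) : Prop := ∃ a b : ℝ, ∀ t ∈ I, Ψ t = a * t + b

theorem segIntegral_eq_sub {g G : ℂ → ℂ} (hg : ContinuousOn g unitDisk)
    (hG : ∀ z ∈ unitDisk, HasDerivAt G (g z) z) {z : ℂ} (hz : z ∈ unitDisk) :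
    segIntegral g z = G z - G 0 := by
  have hmem : ∀ t ∈ Set.uIcc (0 : ℝ) 1, (t : ℂ) * z ∈ unitDisk := by
    intro t ht
    rw [Set.uIcc_of_le zero_le_one] at ht
    simp only [unitDisk, mem_ball_zero_iff, norm_mul, Complex.norm_real, Real.norm_eq_abs,
      abs_of_nonneg ht.1] at hz ⊢
    nlinarith [ht.1, ht.2, norm_nonneg z]
  have h : ∀ t ∈ Set.uIcc (0 : ℝ) 1,
      HasDerivAt (fun t : ℝ => G ((t : ℂ) * z)) (g ((t : ℂ) * z) * z) t := by
    intro t ht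
    have h1 : HasDerivAt (fun t : ℝ => (t : ℂ) * z) z t := by
      simpa using (Complex.ofRealCLM.hasDerivAt (x := t)).mul_const z
    exact (hG _ (hmem t ht)).comp t h1
  have hc : ContinuousOn (fun t : ℝ => g ((t : ℂ) * z) * z) (Set.uIcc (0 : ℝ) 1) :=
    (hg.comp (by fun_prop) hmem).mul continuousOn_const
  have := intervalIntegral.integral_eq_sub_of_hasDerivAt h hc.intervalIntegrable
  simpa [segIntegral] using this

/-- `logDer f` is the holomorphic branch of `log f'` on the unit disk that vanishes at `0`. -/
theorem logDer_spec {Ω : Set ℂ} {f : ℂ → ℂ} (hf : MemC Ω f) :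
    DifferentiableOn ℂ (logDer f) unitDisk ∧ logDer f 0 = 0 ∧
      ∀ z ∈ unitDisk, Complex.exp (logDer f z) = deriv f z := by
  have h0 : (0 : ℂ) ∈ unitDisk := by simp [unitDisk]
  have ho : IsOpen unitDisk := Metric.isOpen_ball
  have hd := hf.holomorphic.deriv ho
  have hq := (hd.deriv ho).div hd hf.deriv_ne_zero
  obtain ⟨G, hG⟩ := hq.isExactOn_ball
  have hL : ∀ z ∈ unitDisk, logDer f z = G z - G 0 := fun z hz =>
    segIntegral_eq_sub hq.continuousOn hG hz
  refine ⟨?_, by simp [logDer, segIntegral], ?_⟩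
  · refine DifferentiableOn.congr (f := fun z => G z - G 0) (fun z hz => ?_) hL
    exact ((hG z hz).differentiableAt.sub_const _).differentiableWithinAt
  · intro z hz
    have hder : ∀ w ∈ unitDisk,
        HasDerivAt (fun w => deriv f w * Complex.exp (-(G w - G 0))) 0 w := by
      intro w hw
      have h1 : HasDerivAt (deriv f) (deriv (deriv f) w) w :=
        (hd.differentiableAt (ho.mem_nhds hw)).hasDerivAt
      refine (h1.mul (((hG w hw).sub_const (G 0)).neg.cexp)).congr_deriv ?_
      have hne := hf.deriv_ne_zero w hw
      have e : (deriv (deriv f) / deriv f) w = deriv (deriv f) w / deriv f w := rfl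
      rw [e]
      field_simp
      ring
    have hconst := (convex_ball (0 : ℂ) 1).is_const_of_fderivWithin_eq_zero (𝕜 := ℂ)
      (f := fun w => deriv f w * Complex.exp (-(G w - G 0)))
      (fun w hw => (hder w hw).differentiableAt.differentiableWithinAt)
      (fun w hw => by
        rw [fderivWithin_of_isOpen Metric.isOpen_ball hw, (hder w hw).hasFDerivAt.fderiv]; ext; simp) hz h0
    simp only [sub_self, neg_zero, Complex.exp_zero, mul_one, hf.deriv_zero] at hconst
    rw [hL z hz, ← mul_one (Complex.exp _), ← hconst, mul_left_comm, ← Complex.exp_add]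
    simp

end ConvexMeans

end

namespace ConvexMeans

open Metric Set Filter Topology Real

/-! Write `F = log f'` and `K = log k'`, where `k` is the extremal function. Then `z K' = φ - 1`.
The function `1 + z F'` maps the disk into `Ω` and sends `0` to `1`, so `z F'(z) = φ(w) - 1` with
`|w| ≤ |z|` by the Schwarz lemma. Everything follows from the subordination `F = K ∘ ω` with `|ω(z)|
≤ |z|`.

The subordination is obtained without proving `K` univalent. Since `K' ≠ 0`, a lift `ω` of `F`
through `K` exists near `0`, and it can be continued as long as it stays away from the unit circle.
Jack's lemma supplies this a priori bound: where `|ω|` is maximal on a circle, `z ω' = m ω` with `m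
≥ 1`, so `φ(ω) - 1` is `1/m` times `φ(w) - 1`. Starlikeness then gives `|ω| ≤ |w| ≤ |z|`. The same
principle applied to `s K`, `0 < s < 1`, shows that `K` vanishes only at `0`, so `K = z exp L`.

If `ω` is a rotation, then `f` is a rotation of `k` and the means agree. Otherwise `ω` maps the
closed disk of radius `r` into the open one. A function `u` below its Poisson integral then
satisfies Littlewood's inequality: the mean of `u ∘ ω` is at most the mean of `P[u] ∘ ω`, which
equals `P[u](0)`, the mean of `u`. It is strict when `u < P[u]` inside. This is used for `u = |K|^p`
and, with `c = 1` or `c = -i`, for `u = Ψ(Re(cK))`. The logarithmic mean follows directly from `K =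
z exp L` and the mean value property of `Re L`. -/

/-! ### Continuation of lifts through a locally univalent function -/

/-- Compactness makes the inverse function theorem uniform: `|K'|` has a positive minimum `m` on the
closed disk of radius `R`, and `K'` varies by at most `m / 2` over distance `δ`. Subtracting the
linear part of `K` at `w` shows that `K` expands distances on `ball w δ` by a factor at least `m /
2`. The point is that `δ` and `ε` do not depend on `w`. -/
theorem exists_uniform_local_inverse {K : ℂ → ℂ} {R : ℝ} (hR0 : 0 ≤ R) (hR : R < 1)
    (hK : DifferentiableOn ℂ K (ball 0 1)) (hK' : ∀ z ∈ ball (0 : ℂ) 1, deriv K z ≠ 0) :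
    ∃ δ > 0, ∃ ε > 0, ∀ w : ℂ, ‖w‖ ≤ R → ball w δ ⊆ ball 0 1 ∧ InjOn K (ball w δ) ∧
      ball (K w) ε ⊆ K '' ball w δ := by
  have hd : DifferentiableOn ℂ (deriv K) (ball 0 1) := hK.deriv isOpen_ball
  have hsub : closedBall (0 : ℂ) R ⊆ ball 0 1 := closedBall_subset_ball hR
  obtain ⟨w₀, hw₀, hmin⟩ := (isCompact_closedBall (0 : ℂ) R).exists_isMinOn
    ⟨0, mem_closedBall_self hR0⟩ ((hd.continuousOn.mono hsub).norm)
  set m := ‖deriv K w₀‖ with hm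
  have hm0 : 0 < m := norm_pos_iff.2 (hK' w₀ (hsub hw₀))
  have huc : UniformContinuousOn (deriv K) (closedBall (0 : ℂ) ((1 + R) / 2)) :=
    (isCompact_closedBall _ _).uniformContinuousOn_of_continuous
      (hd.continuousOn.mono (closedBall_subset_ball (by linarith)))
  obtain ⟨δ₁, hδ₁, hδ⟩ := Metric.uniformContinuousOn_iff.1 huc (m / 2) (by positivity)
  set δ := min δ₁ ((1 - R) / 2) with hδdef
  have hδ0 : 0 < δ := lt_min hδ₁ (by linarith)
  have hball : ∀ w : ℂ, ‖w‖ ≤ R → ball w δ ⊆ closedBall 0 ((1 + R) / 2) := by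
    intro w hw v hv
    have h1 : ‖v - w‖ < (1 - R) / 2 := (mem_ball_iff_norm.1 hv).trans_le (min_le_right _ _)
    have h2 : ‖v‖ ≤ ‖v - w‖ + ‖w‖ := by simpa using norm_add_le (v - w) w
    simp; linarith
  have hsub' : closedBall (0 : ℂ) ((1 + R) / 2) ⊆ ball 0 1 := closedBall_subset_ball (by linarith)
  have key : ∀ w : ℂ, ‖w‖ ≤ R → ∀ u ∈ ball w δ, ∀ v ∈ ball w δ,
      m / 2 * ‖v - u‖ ≤ ‖K v - K u‖ := by
    intro w hw u hu v hv
    have h1 : ∀ x ∈ ball w δ, HasDerivWithinAt (fun x => K x - deriv K w * x)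
        (deriv K x - deriv K w) (ball w δ) x := by
      intro x hx
      have hx1 := hsub' (hball w hw hx)
      have h3 := (hK.differentiableAt (isOpen_ball.mem_nhds hx1)).hasDerivAt
      have h4 := (h3.sub ((hasDerivAt_id x).const_mul (deriv K w))).hasDerivWithinAt (s := ball w δ)
      rw [mul_one] at h4
      exact h4
    have h2 : ∀ x ∈ ball w δ, ‖deriv K x - deriv K w‖ ≤ m / 2 := by
      intro x hx
      have := hδ x (hball w hw hx) w (hball w hw (mem_ball_self hδ0))
        ((mem_ball.1 hx).trans_le (min_le_left _ _))
      rw [dist_eq_norm] at this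
      exact this.le
    have h3 := (convex_ball w δ).norm_image_sub_le_of_norm_hasDerivWithin_le h1 h2 hu hv
    have h4 : m ≤ ‖deriv K w‖ := hmin (by simpa using hw)
    have h5 : ‖deriv K w * (v - u)‖ ≤ ‖K v - K u‖ +
        ‖K v - deriv K w * v - (K u - deriv K w * u)‖ := by
      have := norm_sub_le (K v - K u) (K v - deriv K w * v - (K u - deriv K w * u))
      refine le_trans (le_of_eq ?_) this
      congr 1; ring
    rw [norm_mul] at h5
    nlinarith [norm_nonneg (v - u)]
  -- On the circle of radius `δ / 2` about `w`, `K` stays at distance at least `m / 2 * (δ / 2)`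
  -- from `K w`. The quantitative open mapping theorem covers half of that radius.
  refine ⟨δ, hδ0, m / 2 * (δ / 2) / 2, by positivity, fun w hw => ⟨(hball w hw).trans hsub', ?_, ?_⟩⟩
  · intro u hu v hv huv
    have := key w hw u hu v hv
    rw [huv, sub_self, norm_zero] at this
    have h6 : ‖v - u‖ ≤ 0 := by
      by_contra h
      push Not at h
      nlinarith
    rw [norm_le_zero_iff, sub_eq_zero] at h6
    exact h6.symm
  · have hcb : closedBall w (δ / 2) ⊆ ball w δ := closedBall_subset_ball (by linarith)
    have hw1 : w ∈ ball w δ := mem_ball_self hδ0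
    have h1 : DiffContOnCl ℂ K (ball w (δ / 2)) := by
      apply DifferentiableOn.diffContOnCl_ball (U := ball 0 1) hK
      exact hcb.trans ((hball w hw).trans hsub')
    have h2 : ∃ᶠ z in 𝓝 w, K z ≠ K w := by
      have : ∃ᶠ z in 𝓝[≠] w, K z ≠ K w := by
        apply Eventually.frequently
        have : ∀ᶠ z in 𝓝[≠] w, z ∈ ball w δ :=
          nhdsWithin_le_nhds (isOpen_ball.mem_nhds hw1)
        filter_upwards [this, self_mem_nhdsWithin] with z hz hzw heq
        have := key w hw w hw1 z hz
        rw [heq, sub_self, norm_zero] at this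
        have h6 : 0 < ‖z - w‖ := norm_pos_iff.2 (sub_ne_zero.2 hzw)
        nlinarith
      exact this.filter_mono nhdsWithin_le_nhds
    refine (h1.ball_subset_image_closedBall (by positivity) (fun z hz => ?_) h2).trans
      (image_mono hcb)
    have := key w hw w hw1 z (hcb (sphere_subset_closedBall hz))
    rwa [mem_sphere_iff_norm.1 hz] at this

/-- `ω` is a holomorphic lift of `F` through `K` on the disk of radius `ρ`, fixing `0`. -/
structure IsDiskLift (K F : ℂ → ℂ) (ρ : ℝ) (ω : ℂ → ℂ) : Prop where
  diff : DifferentiableOn ℂ ω (ball 0 ρ)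
  map_zero : ω 0 = 0
  mapsTo : MapsTo ω (ball 0 ρ) (ball 0 1)
  lift : ∀ z ∈ ball (0 : ℂ) ρ, K (ω z) = F z

theorem IsDiskLift.mono {K F ω : ℂ → ℂ} {ρ ρ' : ℝ} (h : IsDiskLift K F ρ ω) (hρ : ρ' ≤ ρ) :
    IsDiskLift K F ρ' ω :=
  have hs := ball_subset_ball hρ
  ⟨h.diff.mono hs, h.map_zero, h.mapsTo.mono_left hs, fun z hz => h.lift z (hs hz)⟩

/-- Lifting a function that stays close to `K ∘ b` for a continuous base function `b`. -/
theorem exists_isDiskLift_of_close {K F b : ℂ → ℂ} {R δ ε ρ : ℝ}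
    (hK : DifferentiableOn ℂ K (ball 0 1)) (hK' : ∀ z ∈ ball (0 : ℂ) 1, deriv K z ≠ 0)
    (hδ : ∀ w : ℂ, ‖w‖ ≤ R → ball w δ ⊆ ball 0 1 ∧ InjOn K (ball w δ) ∧
      ball (K w) ε ⊆ K '' ball w δ) (hδ0 : 0 < δ)
    (hF : DifferentiableOn ℂ F (ball 0 ρ)) (hρ : 0 < ρ) (hb : ContinuousOn b (ball 0 ρ))
    (hb0 : b 0 = 0) (hbR : ∀ z ∈ ball (0 : ℂ) ρ, ‖b z‖ ≤ R) (hFK : F 0 = K 0)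
    (hclose : ∀ z ∈ ball (0 : ℂ) ρ, ‖F z - K (b z)‖ < ε) : ∃ ω, IsDiskLift K F ρ ω := by
  have hex : ∀ z : ℂ, ∃ v, z ∈ ball (0 : ℂ) ρ → v ∈ ball (b z) δ ∧ K v = F z := by
    intro z
    by_cases hz : z ∈ ball (0 : ℂ) ρ
    · obtain ⟨v, hv, hv2⟩ := (hδ (b z) (hbR z hz)).2.2 (mem_ball_iff_norm.2 (hclose z hz))
      exact ⟨v, fun _ => ⟨hv, hv2⟩⟩
    · exact ⟨0, fun h => (hz h).elim⟩
  choose ω hω using hex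
  have h00 : (0 : ℂ) ∈ ball (0 : ℂ) ρ := mem_ball_self hρ
  have hmaps : MapsTo ω (ball 0 ρ) (ball 0 1) := fun z hz =>
    (hδ (b z) (hbR z hz)).1 (hω z hz).1
  refine ⟨ω, ⟨fun z hz => DifferentiableAt.differentiableWithinAt ?_, ?_, hmaps,
    fun z hz => (hω z hz).2⟩⟩
  · have hzn := isOpen_ball.mem_nhds hz
    have hFd := hF.differentiableAt hzn
    have hv1 := hmaps hz
    have hKs : HasStrictDerivAt K (deriv K (ω z)) (ω z) :=
      ((hK.analyticAt (isOpen_ball.mem_nhds hv1)).hasStrictDerivAt)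
    have hne := hK' _ hv1
    have hs := hKs.hasStrictFDerivAt_equiv hne
    set g := hKs.localInverse K _ (ω z) hne with hg
    have hFz : F z = K (ω z) := (hω z hz).2.symm
    have hgr : ∀ᶠ y in 𝓝 (K (ω z)), K (g y) = y := hs.eventually_right_inverse
    have hgc : ContinuousAt g (K (ω z)) := (hKs.to_localInverse hne).hasDerivAt.continuousAt
    have hgz : g (K (ω z)) = ω z := hs.eventually_left_inverse.self_of_nhds
    have hgF : ContinuousAt (fun y => g (F y)) z := by
      apply ContinuousAt.comp (f := F) (g := g) _ hFd.continuousAt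
      rw [hFz]; exact hgc
    have hbz : ContinuousAt b z := hb.continuousAt hzn
    have hnear : ∀ᶠ y in 𝓝 z, dist (g (F y)) (b y) < δ := by
      apply (hgF.dist hbz).eventually_lt continuousAt_const
      simp only [hFz, hgz]
      exact (hω z hz).1
    have hFc := hFd.continuousAt.tendsto
    rw [hFz] at hFc
    -- Although `ω` is chosen pointwise, it coincides near `z` with the local branch `g ∘ F`: both
    -- values lie within `δ` of `b y`, where `K` is injective. Continuity of `b` is what makes this
    -- possible.
    have heq : ω =ᶠ[𝓝 z] fun y => g (F y) := by
      filter_upwards [hnear, hzn, hFc.eventually hgr] with y hy hy1 hy2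
      refine (hδ (b y) (hbR y hy1)).2.1 (hω y hy1).1 hy ?_
      rw [hy2, (hω y hy1).2]
    have hgd : DifferentiableAt ℂ g (F z) := by
      rw [hFz]; exact (hKs.to_localInverse hne).hasDerivAt.differentiableAt
    exact (hgd.comp z hFd).congr_of_eventuallyEq heq
  · have h1 := hω 0 h00
    have h2 := hδ (b 0) (hbR 0 h00)
    rw [hb0] at h1 h2
    exact h2.2.1 h1.1 (mem_ball_self hδ0) (by rw [h1.2, hFK])

/-- Continuation of lifts: if every lift of `F` through the locally univalent function `K`
satisfies the bound of the Schwarz lemma, then lifts exist on all smaller disks. -/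
theorem exists_isDiskLift {K F : ℂ → ℂ}
    (hK : DifferentiableOn ℂ K (ball 0 1)) (hK' : ∀ z ∈ ball (0 : ℂ) 1, deriv K z ≠ 0)
    (hF : DifferentiableOn ℂ F (ball 0 1)) (hFK : F 0 = K 0)
    (hbound : ∀ ρ ω, ρ < 1 → IsDiskLift K F ρ ω → ∀ z ∈ ball (0 : ℂ) ρ, ‖ω z‖ ≤ ‖z‖)
    {R : ℝ} (hR0 : 0 < R) (hR : R < 1) : ∃ ω, IsDiskLift K F R ω := by
  obtain ⟨δ, hδ0, ε, hε, hloc⟩ := exists_uniform_local_inverse hR0.le hR hK hK'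
  have huc : UniformContinuousOn F (closedBall (0 : ℂ) ((1 + R) / 2)) :=
    (isCompact_closedBall _ _).uniformContinuousOn_of_continuous
      (hF.continuousOn.mono (closedBall_subset_ball (by linarith)))
  obtain ⟨δ₁, hδ₁, hFδ⟩ := Metric.uniformContinuousOn_iff.1 huc ε hε
  set ρ₀ := min δ₁ R with hρ₀
  have hρ₀0 : 0 < ρ₀ := lt_min hδ₁ hR0
  have hstart : ∃ ω, IsDiskLift K F ρ₀ ω := by
    refine exists_isDiskLift_of_close (b := fun _ => 0) hK hK' hloc hδ0
      (hF.mono (ball_subset_ball ((min_le_right _ _).trans hR.le))) hρ₀0 continuousOn_const rfl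
      (fun z _ => by simpa using hR0.le) hFK (fun z hz => ?_)
    rw [← hFK, ← dist_eq_norm]
    have hz1 := mem_ball_zero_iff.1 hz
    refine hFδ z ?_ 0 ?_ ?_
    · simp; linarith [hz1.trans_le (min_le_right _ _)]
    · simp; linarith
    · simpa using hz1.trans_le (min_le_left _ _)
  -- The ratio `η` depends only on `R` and on the modulus of continuity of `F`, not on the radius
  -- already reached, so finitely many enlargements suffice.
  obtain ⟨η, hη1, hηR, hηδ⟩ : ∃ η : ℝ, 1 < η ∧ η * R < (1 + R) / 2 ∧ η - 1 < δ₁ := by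
    have h1 : ∀ᶠ η : ℝ in 𝓝[>] 1, η * R < (1 + R) / 2 := by
      apply nhdsWithin_le_nhds
      apply (continuousAt_id.mul continuousAt_const).eventually_lt continuousAt_const
      simp; linarith
    have h2 : ∀ᶠ η : ℝ in 𝓝[>] 1, η - 1 < δ₁ := by
      apply nhdsWithin_le_nhds
      apply (continuousAt_id.sub continuousAt_const).eventually_lt continuousAt_const
      simpa using hδ₁
    have h3 : ∀ᶠ η : ℝ in 𝓝[>] 1, 1 < η := self_mem_nhdsWithin
    exact (h3.and (h1.and h2)).exists
  have hη0 : 0 < η := by linarith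
  -- The base function on the larger disk is the dilation `ω (z / η)`. There `K (b z) = F (z / η)`
  -- is within `ε` of `F z`, and the Schwarz bound keeps `b` inside the disk of radius `R`.
  have hstep : ∀ ρ, 0 < ρ → ρ ≤ R → (∃ ω, IsDiskLift K F ρ ω) → ∃ ω, IsDiskLift K F (η * ρ) ω := by
    rintro ρ hρ0 hρR ⟨ω, hω⟩
    have hηρ : η * ρ < (1 + R) / 2 := (mul_le_mul_of_nonneg_left hρR hη0.le).trans_lt hηR
    have hdiv : ∀ z ∈ ball (0 : ℂ) (η * ρ), z / (η : ℂ) ∈ ball (0 : ℂ) ρ := by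
      intro z hz
      rw [mem_ball_zero_iff] at hz ⊢
      rw [norm_div, Complex.norm_real, Real.norm_eq_abs, abs_of_pos hη0, div_lt_iff₀ hη0]
      linarith
    have hle := hbound ρ ω (by linarith) hω
    refine exists_isDiskLift_of_close (b := fun z => ω (z / (η : ℂ))) hK hK' hloc hδ0
      (hF.mono (ball_subset_ball (by linarith))) (by positivity)
      (hω.diff.continuousOn.comp (by fun_prop) hdiv) (by simp [hω.map_zero]) (fun z hz => ?_) hFK
      (fun z hz => ?_)
    · exact (hle _ (hdiv z hz)).trans ((mem_ball_zero_iff.1 (hdiv z hz)).le.trans hρR)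
    · have hz1 := mem_ball_zero_iff.1 hz
      have hz2 := mem_ball_zero_iff.1 (hdiv z hz)
      rw [hω.lift _ (hdiv z hz), ← dist_eq_norm]
      refine hFδ z ?_ _ ?_ ?_
      · simp; linarith
      · rw [mem_closedBall_zero_iff]; linarith
      · have h3 : z - z / (η : ℂ) = (η - 1 : ℂ) * (z / η) := by
          have : (η : ℂ) ≠ 0 := by exact_mod_cast hη0.ne'
          field_simp
        rw [dist_eq_norm, h3, norm_mul]
        have h4 : ‖(η - 1 : ℂ)‖ = η - 1 := by
          rw [← Complex.ofReal_one, ← Complex.ofReal_sub, Complex.norm_real, Real.norm_eq_abs,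
            abs_of_pos (by linarith)]
        rw [h4]
        nlinarith [norm_nonneg (z / (η : ℂ))]
  have hind : ∀ n : ℕ, ∃ ω, IsDiskLift K F (min R (ρ₀ * η ^ n)) ω := by
    intro n
    induction n with
    | zero => obtain ⟨ω, hω⟩ := hstart; exact ⟨ω, hω.mono (by simp)⟩
    | succ n ih =>
      obtain ⟨ω, hω⟩ := hstep _ (lt_min hR0 (by positivity)) (min_le_left _ _) ih
      refine ⟨ω, hω.mono ?_⟩
      rw [mul_min_of_nonneg _ _ hη0.le]
      refine min_le_min ?_ (by rw [pow_succ]; linarith)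
      nlinarith
  obtain ⟨n, hn⟩ := pow_unbounded_of_one_lt (R / ρ₀) hη1
  obtain ⟨ω, hω⟩ := hind n
  refine ⟨ω, hω.mono (le_min le_rfl ?_)⟩
  rw [div_lt_iff₀ hρ₀0] at hn
  linarith

/-! ### Conformal maps onto starlike domains, and Jack's lemma -/

/-- The inverse of a holomorphic bijection of the unit disk is holomorphic. -/
theorem exists_holomorphic_inverse {Ω : Set ℂ} {φ : ℂ → ℂ} (hΩ : IsOpen Ω)
    (hφ : DifferentiableOn ℂ φ (ball 0 1)) (hb : BijOn φ (ball 0 1) Ω) :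
    ∃ ψ : ℂ → ℂ, DifferentiableOn ℂ ψ Ω ∧ MapsTo ψ Ω (ball 0 1) ∧ (∀ w ∈ Ω, φ (ψ w) = w) ∧
      ∀ z ∈ ball (0 : ℂ) 1, ψ (φ z) = z := by
  set ψ := Function.invFunOn φ (ball 0 1)
  have hmaps : MapsTo ψ Ω (ball 0 1) := hb.surjOn.mapsTo_invFunOn
  have hr : ∀ w ∈ Ω, φ (ψ w) = w := fun w hw => hb.surjOn.rightInvOn_invFunOn hw
  have hl : ∀ z ∈ ball (0 : ℂ) 1, ψ (φ z) = z := fun z hz => hb.injOn.leftInvOn_invFunOn hz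
  have hpre : IsPreconnected (ball (0 : ℂ) 1) := (convex_ball 0 1).isPreconnected
  have hnc : ∀ c, ¬ ∀ z ∈ ball (0 : ℂ) 1, φ z = c := by
    intro c hc
    have h0 : (0 : ℂ) ∈ ball (0 : ℂ) 1 := by simp
    have h1 : (1 / 2 : ℂ) ∈ ball (0 : ℂ) 1 := by simp; norm_num
    have := hb.injOn h0 h1 (by rw [hc _ h0, hc _ h1])
    norm_num at this
  have hopen : ∀ s ⊆ ball (0 : ℂ) 1, IsOpen s → IsOpen (φ '' s) := by
    rcases (hφ.analyticOnNhd isOpen_ball).is_constant_or_isOpen hpre with ⟨c, hc⟩ | h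
    · exact (hnc c hc).elim
    · exact h
  have hcont : ∀ w ∈ Ω, ContinuousAt ψ w := by
    intro w hw N hN
    have hopenN : IsOpen (φ '' (interior N ∩ ball 0 1)) :=
      hopen _ inter_subset_right (isOpen_interior.inter isOpen_ball)
    have hwm : w ∈ φ '' (interior N ∩ ball 0 1) :=
      ⟨ψ w, ⟨mem_interior_iff_mem_nhds.2 hN, hmaps hw⟩, hr w hw⟩
    rw [mem_map]
    filter_upwards [hopenN.mem_nhds hwm]
    rintro _ ⟨z, hz, rfl⟩
    simp only [mem_preimage]
    rw [hl z hz.2]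
    exact interior_subset hz.1
  refine ⟨ψ, fun w hw => DifferentiableAt.differentiableWithinAt ?_, hmaps, hr, hl⟩
  -- Non-vanishing of `φ'` need not be proved: its zeros are isolated, so `ψ` is differentiable on a
  -- punctured neighbourhood of `w` and continuous at `w`, and the singularity is removable.
  have hd : ∀ᶠ z in 𝓝[≠] (ψ w), deriv φ z ≠ 0 := by
    by_contra hcon
    have hfr : ∃ᶠ z in 𝓝[≠] (ψ w), deriv φ z = 0 := fun h => hcon h
    have h0 := ((hφ.deriv isOpen_ball).analyticOnNhd isOpen_ball).eqOn_zero_of_preconnected_of_frequently_eq_zero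
      hpre (hmaps hw) hfr
    obtain ⟨c, hc⟩ := isOpen_ball.exists_is_const_of_deriv_eq_zero hpre hφ h0
    exact hnc c hc
  refine (Complex.analyticAt_of_differentiable_on_punctured_nhds_of_continuousAt ?_
    (hcont w hw)).differentiableAt
  have hten : Tendsto ψ (𝓝[≠] w) (𝓝[≠] (ψ w)) := by
    refine tendsto_nhdsWithin_iff.2 ⟨(hcont w hw).mono_left nhdsWithin_le_nhds, ?_⟩
    filter_upwards [self_mem_nhdsWithin, nhdsWithin_le_nhds (hΩ.mem_nhds hw)] with y hy hyΩ heq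
    exact hy (by rw [mem_singleton_iff, ← hr y hyΩ, heq, hr w hw])
  filter_upwards [hten.eventually hd, nhdsWithin_le_nhds (hΩ.mem_nhds hw)] with y hy hyΩ
  refine (HasDerivAt.of_local_left_inverse (hcont y hyΩ)
    (hφ.differentiableAt (isOpen_ball.mem_nhds (hmaps hyΩ))).hasDerivAt hy ?_).differentiableAt
  filter_upwards [hΩ.mem_nhds hyΩ] with x hx using hr x hx

/-- A conformal map onto a domain starlike with respect to `1` contracts towards the origin
along segments towards `1`. -/
theorem norm_le_of_starConvex {Ω : Set ℂ} {φ ψ : ℂ → ℂ} (hstar : StarConvex ℝ (1 : ℂ) Ω)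
    (hφ : DifferentiableOn ℂ φ (ball 0 1)) (hm : MapsTo φ (ball 0 1) Ω) (h0 : φ 0 = 1)
    (hψ : DifferentiableOn ℂ ψ Ω) (hψm : MapsTo ψ Ω (ball 0 1))
    (hl : ∀ z ∈ ball (0 : ℂ) 1, ψ (φ z) = z) {a b : ℂ} (ha : a ∈ ball (0 : ℂ) 1)
    (hb : b ∈ ball (0 : ℂ) 1) {s : ℝ} (hs0 : 0 ≤ s) (hs1 : s ≤ 1)
    (hab : φ a - 1 = s * (φ b - 1)) : ‖a‖ ≤ ‖b‖ := by
  have hmaps : MapsTo (fun z => 1 + s * (φ z - 1)) (ball (0 : ℂ) 1) Ω := fun z hz => by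
    simpa using hstar.add_smul_sub_mem (hm hz) hs0 hs1
  have h1 := Complex.norm_le_norm_of_mapsTo_ball (f := fun z => ψ (1 + s * (φ z - 1)))
    (hψ.comp (by fun_prop) hmaps) (fun z hz => ball_subset_closedBall (hψm (hmaps hz)))
    (by have := hl 0 (by simp); rw [h0] at this; simp [h0, this]) (mem_ball_zero_iff.1 hb)
  have h2 : 1 + s * (φ b - 1) = φ a := by rw [← hab]; ring
  simpa only [h2, hl a ha] using h1

theorem hasDerivAt_nonneg_of_le_left {u : ℝ → ℝ} {d x : ℝ} (h : HasDerivAt u d x)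
    (hu : ∀ t < x, u t ≤ u x) : 0 ≤ d := by
  have h1 := (hasDerivAt_iff_tendsto_slope.1 h).mono_left
    (nhdsWithin_mono x (fun t (ht : t ∈ Iio x) => ne_of_lt ht))
  refine ge_of_tendsto h1 ?_
  filter_upwards [self_mem_nhdsWithin] with t ht
  rw [slope_def_field]
  exact div_nonneg_of_nonpos (sub_nonpos.2 (hu t ht)) (sub_nonpos.2 (le_of_lt ht))

/-- **Jack's lemma**. -/
theorem exists_one_le_mul_deriv_eq {ω : ℂ → ℂ} {ρ : ℝ} (hω : DifferentiableOn ℂ ω (ball 0 ρ))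
    (h0 : ω 0 = 0) {z₀ : ℂ} (hz₀ : z₀ ∈ ball (0 : ℂ) ρ)
    (hmax : ∀ z, ‖z‖ = ‖z₀‖ → ‖ω z‖ ≤ ‖ω z₀‖) (hne : ω z₀ ≠ 0) :
    ∃ m : ℝ, 1 ≤ m ∧ z₀ * deriv ω z₀ = m * ω z₀ := by
  have hz0 : z₀ ≠ 0 := fun h => hne (by rw [h, h0])
  have hr : 0 < ‖z₀‖ := norm_pos_iff.2 hz0
  have hcb : closedBall (0 : ℂ) ‖z₀‖ ⊆ ball 0 ρ := closedBall_subset_ball (mem_ball_zero_iff.1 hz₀)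
  have hmaps : MapsTo ω (ball 0 ‖z₀‖) (closedBall (ω 0) ‖ω z₀‖) := by
    intro z hz
    rw [h0, mem_closedBall_zero_iff]
    refine Complex.norm_le_of_forall_mem_frontier_norm_le isBounded_ball
      (DifferentiableOn.diffContOnCl_ball hω hcb) (fun y hy => ?_) (subset_closure hz)
    rw [frontier_ball _ hr.ne', mem_sphere_zero_iff_norm] at hy
    exact hmax y hy
  have hschw : ∀ z, ‖z‖ < ‖z₀‖ → ‖ω z‖ ≤ ‖ω z₀‖ / ‖z₀‖ * ‖z‖ := by
    intro z hz
    have := Complex.dist_le_div_mul_dist_of_mapsTo_ball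
      (hω.mono (ball_subset_closedBall.trans hcb)) hmaps (mem_ball_zero_iff.2 hz)
    simpa [h0] using this
  set A := z₀ * deriv ω z₀ / ω z₀ with hA
  -- In the coordinate `z = z₀ exp s`, radial motion is real `s` and motion along the circle is
  -- imaginary `s`. The claim becomes that `A` is real and at least `1`.
  have hq : HasDerivAt (fun s : ℂ => ω (z₀ * Complex.exp s) / ω z₀) A 0 := by
    have h1 : HasDerivAt (fun s : ℂ => z₀ * Complex.exp s) z₀ 0 := by
      simpa using (Complex.hasDerivAt_exp 0).const_mul z₀
    have h2 : HasDerivAt ω (deriv ω z₀) (z₀ * Complex.exp 0) := by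
      simpa using (hω.differentiableAt (isOpen_ball.mem_nhds hz₀)).hasDerivAt
    have h3 := (h2.comp (0 : ℂ) h1).div_const (ω z₀)
    rw [mul_comm] at h3
    exact h3
  have hq0 : ω (z₀ * Complex.exp 0) / ω z₀ = 1 := by simp [hne]
  have hne' : 0 < ‖ω z₀‖ := norm_pos_iff.2 hne
  have hre : 1 ≤ A.re := by
    have h1 : HasDerivAt (fun t : ℝ => (ω (z₀ * Complex.exp (t : ℂ)) / ω z₀).re) A.re 0 :=
      HasDerivAt.real_of_complex (z := 0) (by simpa using hq)
    -- The Schwarz lemma gives `Re q(t) ≤ exp t` for `t < 0`, with equality at `t = 0`; comparing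
    -- left derivatives at `0` yields `Re A ≥ 1`.
    have h2 := hasDerivAt_nonneg_of_le_left (h1.sub (Real.hasDerivAt_exp 0)) (fun t ht => by
      have h3 : ‖z₀ * Complex.exp (t : ℂ)‖ = ‖z₀‖ * Real.exp t := by
        rw [norm_mul, Complex.norm_exp, Complex.ofReal_re]
      have h4 : ‖z₀ * Complex.exp (t : ℂ)‖ < ‖z₀‖ := by
        rw [h3]; nlinarith [Real.exp_lt_one_iff.2 ht]
      have h5 := hschw _ h4
      have h6 : ‖ω (z₀ * Complex.exp (t : ℂ)) / ω z₀‖ ≤ Real.exp t := by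
        rw [norm_div, div_le_iff₀ hne']
        refine h5.trans (le_of_eq ?_)
        rw [h3]; field_simp
      have h7 := (Complex.re_le_norm _).trans h6
      simp only [Pi.sub_apply, Complex.ofReal_zero, hq0, Complex.one_re, Real.exp_zero, sub_self]
      linarith)
    rw [Real.exp_zero] at h2
    linarith
  have him : A.im = 0 := by
    have h1 : HasDerivAt (fun s : ℂ => ω (z₀ * Complex.exp (s * Complex.I)) / ω z₀)
        (A * Complex.I) 0 := by
      have h3 : HasDerivAt (fun s : ℂ => s * Complex.I) Complex.I 0 := by
        simpa using (hasDerivAt_id (0 : ℂ)).mul_const Complex.I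
      have h2 : HasDerivAt (fun s : ℂ => ω (z₀ * Complex.exp s) / ω z₀) A (0 * Complex.I) := by
        simpa using hq
      exact h2.comp (0 : ℂ) h3
    have h2 : HasDerivAt (fun t : ℝ => (ω (z₀ * Complex.exp ((t : ℂ) * Complex.I)) / ω z₀).re)
        (A * Complex.I).re 0 := HasDerivAt.real_of_complex (z := 0) (by simpa using h1)
    -- Along the circle `Re q` is maximal at `0`, so its derivative `Re (A i) = -Im A` vanishes.
    have h3 : IsLocalMax
        (fun t : ℝ => (ω (z₀ * Complex.exp ((t : ℂ) * Complex.I)) / ω z₀).re) 0 := by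
      refine Eventually.of_forall fun t => ?_
      have h4 : ‖ω (z₀ * Complex.exp ((t : ℂ) * Complex.I)) / ω z₀‖ ≤ 1 := by
        rw [norm_div, div_le_one hne']
        exact hmax _ (by rw [norm_mul, Complex.norm_exp_ofReal_mul_I, mul_one])
      have h5 := (Complex.re_le_norm _).trans h4
      simpa [hne] using h5
    have h4 := h3.hasDerivAt_eq_zero h2
    simpa using h4
  refine ⟨A.re, hre, ?_⟩
  have h1 : ((A.re : ℝ) : ℂ) = A := Complex.ext (by simp) (by simp [him])
  rw [h1, hA]
  field_simp

/-! ### Subordination from the starlikeness of `z K'` -/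

/-- Starlikeness of `φ - 1`, in the form of a contraction property. -/
def RadiallyOrdered (φ : ℂ → ℂ) : Prop :=
  ∀ a ∈ ball (0 : ℂ) 1, ∀ b ∈ ball (0 : ℂ) 1, ∀ s : ℝ, 0 ≤ s → s ≤ 1 →
    φ a - 1 = s * (φ b - 1) → ‖a‖ ≤ ‖b‖

/-- This is the a priori bound that drives the continuation. It is checked at a maximum point of
`|v|` on the circle through `z`, where Jack's lemma turns `z F'` into a multiple `m ≥ 1` of `φ(v) -
1`. -/
theorem IsDiskLift.norm_le {φ K F v : ℂ → ℂ} (hφ : RadiallyOrdered φ)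
    (hK : DifferentiableOn ℂ K (ball 0 1))
    (hKφ : ∀ z ∈ ball (0 : ℂ) 1, z * deriv K z = φ z - 1)
    (hFφ : ∀ z ∈ ball (0 : ℂ) 1, ∃ w, ‖w‖ ≤ ‖z‖ ∧ z * deriv F z = φ w - 1) {ρ : ℝ} (hρ : ρ < 1)
    (hv : IsDiskLift K F ρ v) {z : ℂ} (hz : z ∈ ball (0 : ℂ) ρ) : ‖v z‖ ≤ ‖z‖ := by
  have hsub : sphere (0 : ℂ) ‖z‖ ⊆ ball 0 ρ := fun y hy => by
    rw [mem_sphere_zero_iff_norm] at hy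
    rw [mem_ball_zero_iff, hy]
    exact mem_ball_zero_iff.1 hz
  obtain ⟨z₀, hz₀, hmax⟩ := (isCompact_sphere (0 : ℂ) ‖z‖).exists_isMaxOn ⟨z, by simp⟩
    ((hv.diff.continuousOn.mono hsub).norm)
  have hzn : ‖z₀‖ = ‖z‖ := by simpa using hz₀
  refine (hmax (by simp : z ∈ sphere (0 : ℂ) ‖z‖)).trans ?_
  show ‖v z₀‖ ≤ ‖z‖
  by_cases hne : v z₀ = 0
  · simp [hne]
  have hz₀ρ := hsub hz₀
  obtain ⟨m, hm, hJ⟩ := exists_one_le_mul_deriv_eq hv.diff hv.map_zero hz₀ρ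
    (fun y hy => hmax (by simpa [hzn] using hy)) hne
  have hm0 : 0 < m := by linarith
  have hz₀1 : z₀ ∈ ball (0 : ℂ) 1 := ball_subset_ball hρ.le hz₀ρ
  have hv1 := hv.mapsTo hz₀ρ
  have hder : deriv K (v z₀) * deriv v z₀ = deriv F z₀ := by
    have h1 := (hK.differentiableAt (isOpen_ball.mem_nhds hv1)).hasDerivAt.comp z₀
      (hv.diff.differentiableAt (isOpen_ball.mem_nhds hz₀ρ)).hasDerivAt
    have h2 : F =ᶠ[𝓝 z₀] K ∘ v := by
      filter_upwards [isOpen_ball.mem_nhds hz₀ρ] with y hy using (hv.lift y hy).symm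
    exact (h1.congr_of_eventuallyEq h2).deriv.symm
  obtain ⟨w, hw, hwF⟩ := hFφ z₀ hz₀1
  rw [← hzn]
  have hw1 : w ∈ ball (0 : ℂ) 1 := mem_ball_zero_iff.2 (hw.trans_lt (mem_ball_zero_iff.1 hz₀1))
  refine (hφ _ hv1 w hw1 m⁻¹ (by positivity) (inv_le_one_of_one_le₀ hm) ?_).trans hw
  have h3 : m * (φ (v z₀) - 1) = φ w - 1 := by
    rw [← hwF, ← hder, ← hKφ _ hv1]
    linear_combination -(deriv K (v z₀)) * hJ
  rw [← h3]
  have : (m : ℂ) ≠ 0 := by exact_mod_cast hm0.ne'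
  push_cast
  field_simp

/-- Suffridge's subordination principle: if `z F'` takes values subordinate to the starlike
function `z K' = φ - 1`, then `F` is subordinate to `K`. -/
theorem exists_subordination {φ K F : ℂ → ℂ} (hφ : RadiallyOrdered φ)
    (hK : DifferentiableOn ℂ K (ball 0 1)) (hK' : ∀ z ∈ ball (0 : ℂ) 1, deriv K z ≠ 0)
    (hKφ : ∀ z ∈ ball (0 : ℂ) 1, z * deriv K z = φ z - 1)
    (hF : DifferentiableOn ℂ F (ball 0 1)) (hFK : F 0 = K 0)
    (hFφ : ∀ z ∈ ball (0 : ℂ) 1, ∃ w, ‖w‖ ≤ ‖z‖ ∧ z * deriv F z = φ w - 1)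
    {R : ℝ} (hR0 : 0 < R) (hR : R < 1) :
    ∃ ω, IsDiskLift K F R ω ∧ ∀ z ∈ ball (0 : ℂ) R, ‖ω z‖ ≤ ‖z‖ := by
  have hb : ∀ ρ ω, ρ < 1 → IsDiskLift K F ρ ω → ∀ z ∈ ball (0 : ℂ) ρ, ‖ω z‖ ≤ ‖z‖ :=
    fun ρ ω hρ hω z hz => hω.norm_le hφ hK hKφ hFφ hρ hz
  obtain ⟨ω, hω⟩ := exists_isDiskLift hK hK' hF hFK hb hR0 hR
  exact ⟨ω, hω, hb R ω hR hω⟩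

/-- Either a holomorphic function obeying the bound of the Schwarz lemma is a rotation,
or the bound is strict off the origin. -/
theorem eq_rotation_or_norm_lt {ω : ℂ → ℂ} {R : ℝ} (hR : 0 < R)
    (hω : DifferentiableOn ℂ ω (ball 0 R)) (hle : ∀ z ∈ ball (0 : ℂ) R, ‖ω z‖ ≤ ‖z‖) :
    (∃ ε : ℂ, ‖ε‖ = 1 ∧ ∀ z ∈ ball (0 : ℂ) R, ω z = ε * z) ∨
      ∀ z ∈ ball (0 : ℂ) R, z ≠ 0 → ‖ω z‖ < ‖z‖ := by
  have h0 : ω 0 = 0 := by simpa using hle 0 (mem_ball_self hR)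
  by_cases h : ∀ z ∈ ball (0 : ℂ) R, z ≠ 0 → ‖ω z‖ < ‖z‖
  · exact Or.inr h
  push Not at h
  obtain ⟨z, hz, hz0, hzle⟩ := h
  left
  have hmaps : MapsTo ω (ball 0 R) (closedBall (ω 0) R) := fun y hy => by
    rw [h0, mem_closedBall_zero_iff]
    exact (hle y hy).trans (mem_ball_zero_iff.1 hy).le
  obtain ⟨C, hC, hCe⟩ := Complex.affine_of_mapsTo_ball_of_exists_norm_dslope_eq_div' hω hmaps
    ⟨z, hz, by
      rw [dslope_of_ne _ hz0, slope_def_field, h0, sub_zero, sub_zero, norm_div,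
        le_antisymm (hle z hz) hzle, div_self (norm_ne_zero_iff.2 hz0), div_self hR.ne']⟩
  rw [div_self hR.ne'] at hC
  refine ⟨C, hC, fun y hy => ?_⟩
  rw [hCe hy, h0]
  simp [mul_comm]

/-! ### The zeros of `K` -/

theorem norm_sub_le_norm_one_sub_mul {s : ℝ} (hs0 : 0 ≤ s) (hs1 : s ≤ 1) {w : ℂ} (hw : ‖w‖ ≤ 1) :
    ‖(s : ℂ) - w‖ ≤ ‖1 - (s : ℂ) * w‖ := by
  refine le_of_sq_le_sq ?_ (norm_nonneg _)
  rw [← Complex.normSq_eq_norm_sq, ← Complex.normSq_eq_norm_sq, Complex.normSq_apply,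
    Complex.normSq_apply]
  have h1 : w.re * w.re + w.im * w.im ≤ 1 := by
    rw [← Complex.normSq_apply, Complex.normSq_eq_norm_sq]
    nlinarith [norm_nonneg w]
  simp
  nlinarith [mul_nonneg (sub_nonneg.2 h1) (sub_nonneg.2 (by nlinarith : s * s ≤ 1))]

/-- The function `K` with `z K' = φ - 1` starlike vanishes to first order at `0` and nowhere
else. -/
theorem dslope_ne_zero_of_radiallyOrdered {Ω : Set ℂ} {φ ψ K : ℂ → ℂ}
    (hstar : StarConvex ℝ (1 : ℂ) Ω) (hm : MapsTo φ (ball 0 1) Ω)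
    (hψm : MapsTo ψ Ω (ball 0 1)) (hr : ∀ w ∈ Ω, φ (ψ w) = w) (hφ : RadiallyOrdered φ)
    (hK : DifferentiableOn ℂ K (ball 0 1)) (hK' : ∀ z ∈ ball (0 : ℂ) 1, deriv K z ≠ 0)
    (hKφ : ∀ z ∈ ball (0 : ℂ) 1, z * deriv K z = φ z - 1) (hK0 : K 0 = 0) :
    ∀ z ∈ ball (0 : ℂ) 1, dslope K 0 z ≠ 0 := by
  have h01 : (0 : ℂ) ∈ ball (0 : ℂ) 1 := by simp
  have hG : DifferentiableOn ℂ (dslope K 0) (ball 0 1) :=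
    (Complex.differentiableOn_dslope (isOpen_ball.mem_nhds h01)).2 hK
  have hKG : ∀ z, K z = z * dslope K 0 z := fun z => by
    have := sub_smul_dslope K 0 z
    simp only [sub_zero, smul_eq_mul, hK0] at this
    exact this.symm
  intro z hz hGz
  have hz1 : ‖z‖ < 1 := mem_ball_zero_iff.1 hz
  have hcpt : IsCompact (closedBall (0 : ℂ) ‖z‖ ∩ dslope K 0 ⁻¹' {0}) :=
    (isCompact_closedBall _ _).of_isClosed_subset
      ((hG.continuousOn.mono (closedBall_subset_ball hz1)).preimage_isClosed_of_isClosed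
        isClosed_closedBall isClosed_singleton) inter_subset_left
  obtain ⟨z₁, ⟨hz₁b, hz₁⟩, hmin⟩ := hcpt.exists_isMinOn ⟨z, by simp, hGz⟩ continuous_norm.continuousOn
  have hz₁n : ‖z₁‖ ≤ ‖z‖ := by simpa using hz₁b
  have hz₁0 : z₁ ≠ 0 := by
    rintro rfl
    rw [mem_preimage, mem_singleton_iff, dslope_same] at hz₁
    exact hK' 0 h01 hz₁
  obtain ⟨R, hR1, hR2⟩ := exists_between (hz₁n.trans_lt hz1)
  have hR0 : 0 < R := (norm_nonneg _).trans_lt hR1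
  -- The contradiction comes from `s > ‖z₁‖ / R`: the Schwarz lemma at the end forces the opposite
  -- inequality. Here `z₁` is a zero of `K z / z` of least modulus.
  obtain ⟨s, hs1, hs2⟩ := exists_between ((div_lt_one hR0).2 hR1)
  have hs0 : 0 ≤ s := (div_nonneg (norm_nonneg z₁) hR0.le).trans hs1.le
  obtain ⟨v, hv, hvle⟩ := exists_subordination (F := fun z => s * K z) hφ hK hK' hKφ
    (hK.const_mul _) (by simp [hK0]) (fun y hy => by
      have hmem : 1 + s * (φ y - 1) ∈ Ω := by
        simpa using hstar.add_smul_sub_mem (hm hy) hs0 hs2.le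
      refine ⟨ψ (1 + s * (φ y - 1)), ?_, ?_⟩
      · exact hφ _ (hψm hmem) y hy s hs0 hs2.le (by rw [hr _ hmem]; ring)
      · rw [hr _ hmem, deriv_const_mul _ (hK.differentiableAt (isOpen_ball.mem_nhds hy)),
          add_sub_cancel_left, ← hKφ y hy]
        ring) hR0 hR2
  have h0R : (0 : ℂ) ∈ ball (0 : ℂ) R := mem_ball_self hR0
  have hz₁R : z₁ ∈ ball (0 : ℂ) R := mem_ball_zero_iff.2 hR1
  have hv0 : deriv v 0 = s := by
    have h1 := (hK.differentiableAt (isOpen_ball.mem_nhds (hv.mapsTo h0R))).hasDerivAt.comp 0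
      (hv.diff.differentiableAt (isOpen_ball.mem_nhds h0R)).hasDerivAt
    have h2 : (fun z => s * K z) =ᶠ[𝓝 0] K ∘ v := by
      filter_upwards [isOpen_ball.mem_nhds h0R] with y hy using (hv.lift y hy).symm
    have h3 := (h1.congr_of_eventuallyEq h2).deriv
    rw [deriv_const_mul _ (hK.differentiableAt (isOpen_ball.mem_nhds h01)), hv.map_zero,
      mul_comm] at h3
    exact (mul_left_cancel₀ (hK' 0 h01) h3).symm
  -- The function `v` cannot be a rotation, because `v'(0) = s < 1`. Hence `‖v z₁‖ < ‖z₁‖`, and a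
  -- nonzero `v z₁` would be a zero of `K` closer to the origin than `z₁`.
  have hvz : v z₁ = 0 := by
    by_contra hvne
    rcases eq_rotation_or_norm_lt hR0 hv.diff hvle with ⟨ε, hε, hrot⟩ | hlt
    · have h1 : v =ᶠ[𝓝 0] fun y => ε * y := by
        filter_upwards [isOpen_ball.mem_nhds h0R] with y hy using hrot y hy
      have h2 := h1.deriv_eq
      rw [hv0, deriv_const_mul _ differentiableAt_id, deriv_id'', mul_one] at h2
      rw [← h2, Complex.norm_real, Real.norm_eq_abs, abs_of_nonneg hs0] at hε
      exact hs2.ne hε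
    · have h1 := hlt z₁ hz₁R hz₁0
      have h2 : dslope K 0 (v z₁) = 0 := by
        have h3 := hv.lift z₁ hz₁R
        rw [hKG z₁, hz₁, mul_zero, mul_zero, hKG (v z₁)] at h3
        exact (mul_eq_zero.1 h3).resolve_left hvne
      have h4 : ‖z₁‖ ≤ ‖v z₁‖ := hmin ⟨by simp; linarith, h2⟩
      linarith
  have hmaps : MapsTo v (ball 0 R) (closedBall (v 0) R) := fun y hy => by
    rw [hv.map_zero, mem_closedBall_zero_iff]
    exact (hvle y hy).trans (mem_ball_zero_iff.1 hy).le
  have hh : ∀ y ∈ ball (0 : ℂ) R, ‖dslope v 0 y‖ ≤ 1 := fun y hy => by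
    simpa [hR0.ne'] using Complex.norm_dslope_le_div_of_mapsTo_ball hv.diff hmaps hy
  have hhd : DifferentiableOn ℂ (dslope v 0) (ball 0 R) :=
    (Complex.differentiableOn_dslope (isOpen_ball.mem_nhds h0R)).2 hv.diff
  have hden : ∀ y ∈ ball (0 : ℂ) R, 1 - s * dslope v 0 y ≠ 0 := fun y hy h => by
    have h1 : ‖(s : ℂ) * dslope v 0 y‖ < 1 := by
      rw [norm_mul, Complex.norm_real, Real.norm_eq_abs, abs_of_nonneg hs0]
      nlinarith [hh y hy, norm_nonneg (dslope v 0 y)]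
    rw [← sub_eq_zero.1 h, norm_one] at h1
    exact lt_irrefl _ h1
  -- With `h = v / z`, one has `h(0) = s`, `h(z₁) = 0` and `|h| ≤ 1`. The Möbius transform `(s - h)
  -- / (1 - s h)` vanishes at `0` and equals `s` at `z₁`, so the Schwarz lemma gives `s ≤ ‖z₁‖ / R`.
  have hM := Complex.dist_le_div_mul_dist_of_mapsTo_ball (c := 0) (R₁ := R) (R₂ := 1) (z := z₁)
    (f := fun y => (s - dslope v 0 y) / (1 - s * dslope v 0 y))
    (((differentiableOn_const _).sub hhd).div ((differentiableOn_const _).sub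
      ((differentiableOn_const _).mul hhd)) hden)
    (fun y hy => by
      simp only [dslope_same, hv0, sub_self, zero_div, mem_closedBall_zero_iff, norm_div]
      exact div_le_one_of_le₀ (norm_sub_le_norm_one_sub_mul hs0 hs2.le (hh y hy)) (norm_nonneg _))
    hz₁R
  rw [dslope_of_ne _ hz₁0, slope_def_field, hvz, hv.map_zero] at hM
  simp [hv0, abs_of_nonneg hs0] at hM
  rw [inv_mul_eq_div] at hM
  linarith

/-! ### Poisson integrals and Littlewood's principle -/

theorem circleAverage_lt_circleAverage {f g : ℂ → ℝ} {r : ℝ} (hr : 0 < r)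
    (hf : ContinuousOn f (sphere 0 r)) (hg : ContinuousOn g (sphere 0 r))
    (hle : ∀ z ∈ sphere (0 : ℂ) r, f z ≤ g z) (hlt : ∃ z ∈ sphere (0 : ℂ) r, f z < g z) :
    circleAverage f 0 r < circleAverage g 0 r := by
  have hmem : ∀ θ : ℝ, circleMap 0 r θ ∈ sphere (0 : ℂ) r := circleMap_mem_sphere 0 hr.le
  have hc : ∀ {h : ℂ → ℝ}, ContinuousOn h (sphere 0 r) →
      Continuous fun θ : ℝ => h (circleMap 0 r θ) := fun hh =>
    hh.comp_continuous (continuous_circleMap 0 r) hmem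
  unfold Real.circleAverage
  rw [smul_eq_mul, smul_eq_mul]
  refine mul_lt_mul_of_pos_left ?_ (by positivity)
  refine intervalIntegral.integral_lt_integral_of_continuousOn_of_le_of_exists_lt (by positivity)
    (hc hf).continuousOn (hc hg).continuousOn (fun θ _ => hle _ (hmem θ)) ?_
  obtain ⟨z, hz, hzlt⟩ := hlt
  have hz' : z ∈ circleMap 0 r '' Ioc 0 (2 * π) := by
    rw [image_circleMap_Ioc, abs_of_pos hr]
    exact hz
  obtain ⟨θ, hθ, rfl⟩ := hz'
  exact ⟨θ, Ioc_subset_Icc_self hθ, hzlt⟩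

/-- The Poisson integral over the circle of radius `r`. -/
noncomputable def poissonMean (r : ℝ) (u : ℂ → ℝ) (w : ℂ) : ℝ := circleAverage (poissonKernel 0 w • u) 0 r

theorem poissonKernel_pos {r : ℝ} {w z : ℂ} (hw : w ∈ ball (0 : ℂ) r) (hz : z ∈ sphere (0 : ℂ) r) :
    0 < poissonKernel 0 w z := by
  rw [mem_ball_zero_iff] at hw
  rw [mem_sphere_zero_iff_norm] at hz
  have hne : z - w ≠ 0 := by
    rintro h
    rw [← sub_eq_zero.1 h] at hw
    linarith
  rw [poissonKernel_def]
  simp only [sub_zero]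
  have := norm_pos_iff.2 hne
  have := norm_nonneg w
  rw [hz]
  have : 0 < r ^ 2 - ‖w‖ ^ 2 := by nlinarith
  positivity

theorem continuousOn_poissonKernel {r : ℝ} {w : ℂ} (hr : 0 < r) (hw : w ∈ ball (0 : ℂ) r) :
    ContinuousOn (poissonKernel 0 w) (sphere 0 r) := by
  rw [poissonKernel_eq_re_herglotzRieszKernel]
  have := continuousOn_herglotzRieszKernel_sphere hw
  rw [abs_of_pos hr] at this
  exact Complex.continuous_re.comp_continuousOn this

theorem circleIntegrable_poisson {r : ℝ} {w : ℂ} {u : ℂ → ℝ} (hr : 0 < r)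
    (hw : w ∈ ball (0 : ℂ) r) (hu : ContinuousOn u (sphere 0 r)) :
    CircleIntegrable (poissonKernel 0 w • u) 0 r :=
  ((continuousOn_poissonKernel hr hw).smul hu).circleIntegrable hr.le

theorem poissonMean_sub {r : ℝ} {w : ℂ} {u v : ℂ → ℝ} (hr : 0 < r)
    (hw : w ∈ ball (0 : ℂ) r) (hu : ContinuousOn u (sphere 0 r))
    (hv : ContinuousOn v (sphere 0 r)) :
    poissonMean r (u - v) w = poissonMean r u w - poissonMean r v w := by
  unfold poissonMean
  rw [smul_sub]
  exact circleAverage_sub (circleIntegrable_poisson hr hw hu) (circleIntegrable_poisson hr hw hv)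

theorem poissonMean_const_mul {r a : ℝ} {w : ℂ} {u : ℂ → ℝ} :
    poissonMean r (fun z => a * u z) w = a * poissonMean r u w := by
  unfold poissonMean
  rw [← smul_eq_mul, ← circleAverage_smul]
  congr 1
  ext z
  simp only [Pi.smul_apply', Pi.smul_apply, Pi.mul_apply, smul_eq_mul]
  ring

theorem poissonMean_congr {r : ℝ} {w : ℂ} {u v : ℂ → ℝ} (hr : 0 < r)
    (h : ∀ z ∈ sphere (0 : ℂ) r, u z = v z) : poissonMean r u w = poissonMean r v w := by
  unfold poissonMean
  refine circleAverage_congr_sphere fun z hz => ?_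
  rw [abs_of_pos hr] at hz
  simp [h z hz]

theorem poissonMean_pos {r : ℝ} {w : ℂ} {u : ℂ → ℝ} (hr : 0 < r) (hw : w ∈ ball (0 : ℂ) r)
    (hu : ContinuousOn u (sphere 0 r)) (h0 : ∀ z ∈ sphere (0 : ℂ) r, 0 ≤ u z)
    (hpos : ∃ z ∈ sphere (0 : ℂ) r, 0 < u z) : 0 < poissonMean r u w := by
  obtain ⟨z, hz, hzu⟩ := hpos
  have := circleAverage_lt_circleAverage (f := fun _ => 0) hr continuousOn_const
    ((continuousOn_poissonKernel hr hw).smul hu)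
    (fun z hz => mul_nonneg (poissonKernel_pos hw hz).le (h0 z hz))
    ⟨z, hz, mul_pos (poissonKernel_pos hw hz) hzu⟩
  rwa [circleAverage_const] at this

theorem poissonMean_nonneg {r : ℝ} {w : ℂ} {u : ℂ → ℝ} (hr : 0 < r) (hw : w ∈ ball (0 : ℂ) r)
    (h0 : ∀ z ∈ sphere (0 : ℂ) r, 0 ≤ u z) : 0 ≤ poissonMean r u w := by
  refine circleAverage_nonneg_of_nonneg fun z hz => ?_
  rw [abs_of_pos hr] at hz
  exact mul_nonneg (poissonKernel_pos hw hz).le (h0 z hz)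

/-- **Poisson formula** for the real part of a holomorphic function. -/
theorem poissonMean_re {r : ℝ} {w : ℂ} {L : ℂ → ℂ} (hr : 0 < r) (hw : w ∈ ball (0 : ℂ) r)
    (hL : DiffContOnCl ℂ L (ball 0 r)) : poissonMean r (fun z => (L z).re) w = (L w).re := by
  have hc : ContinuousOn L (sphere 0 r) :=
    hL.continuousOn.mono (by rw [closure_ball _ hr.ne']; exact sphere_subset_closedBall)
  have h1 : CircleIntegrable (poissonKernel 0 w • L) 0 r :=
    ((continuousOn_poissonKernel hr hw).smul hc).circleIntegrable hr.le
  rw [← hL.circleAverage_poissonKernel_smul hw, poissonMean]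
  have h2 := Complex.reCLM.circleAverage_comp_comm h1
  rw [Complex.reCLM_apply] at h2
  rw [← h2]
  congr 1
  ext z
  simp

theorem poissonMean_const {r c : ℝ} {w : ℂ} (hr : 0 < r) (hw : w ∈ ball (0 : ℂ) r) :
    poissonMean r (fun _ => c) w = c := by
  simpa using poissonMean_re (L := fun _ => (c : ℂ)) hr hw diffContOnCl_const

/-- The mean value of a Poisson integral composed with a holomorphic self-map of the disk
that fixes the origin. -/
theorem circleAverage_poissonMean_comp {r R : ℝ} {u : ℂ → ℝ} {ω : ℂ → ℂ} (hr : 0 < r) (hrR : r < R)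
    (hu : ContinuousOn u (sphere 0 r)) (hω : DifferentiableOn ℂ ω (ball 0 R)) (h0 : ω 0 = 0)
    (hm : MapsTo ω (closedBall 0 r) (ball 0 r)) :
    circleAverage (fun z => poissonMean r u (ω z)) 0 r = circleAverage u 0 r := by
  -- The Poisson integral is the real part of the Herglotz integral `H`, so the claim is the mean
  -- value property of the holomorphic function `H ∘ ω`.
  set H : ℂ → ℂ := fun w => circleAverage (fun ζ => herglotzRieszKernel 0 w ζ • (u ζ : ℂ)) 0 r
    with hH
  have hui : CircleIntegrable u 0 r := hu.circleIntegrable hr.le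
  have huci : CircleIntegrable (fun ζ => (u ζ : ℂ)) 0 r :=
    (Complex.continuous_ofReal.comp_continuousOn hu).circleIntegrable hr.le
  have hHd : DifferentiableOn ℂ H (ball 0 r) :=
    differentiableOn_circleAverage_herglotzRieszKernel_smul huci
  have hHre : ∀ w ∈ ball (0 : ℂ) r, (H w).re = poissonMean r u w := fun w hw => by
    rw [poissonMean, poissonKernel_eq_re_herglotzRieszKernel]
    exact re_circleAverage_herglotzRieszKernel_smul hui hw
  have hcb : closure (ball (0 : ℂ) r) = closedBall 0 r := closure_ball _ hr.ne'
  have hcont : ContinuousOn (fun z => H (ω z)) (closedBall 0 r) :=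
    hHd.continuousOn.comp (hω.continuousOn.mono (closedBall_subset_ball hrR)) hm
  have hd : DiffContOnCl ℂ (fun z => H (ω z)) (ball 0 |r|) := by
    rw [abs_of_pos hr]
    refine ⟨hHd.comp (hω.mono (ball_subset_ball hrR.le)) (hm.mono_left ball_subset_closedBall), ?_⟩
    rw [hcb]
    exact hcont
  have hav := hd.circleAverage
  have hci : CircleIntegrable (fun z => H (ω z)) 0 r :=
    (hcont.mono sphere_subset_closedBall).circleIntegrable hr.le
  have h2 := Complex.reCLM.circleAverage_comp_comm hci
  rw [Complex.reCLM_apply, hav, h0, hHre 0 (mem_ball_self hr)] at h2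
  rw [circleAverage_congr_sphere (f₂ := Complex.reCLM ∘ fun z => H (ω z)), h2, poissonMean]
  · refine circleAverage_congr_sphere fun z hz => ?_
    have hz0 : ‖z‖ ≠ 0 := by
      rw [abs_of_pos hr, mem_sphere_zero_iff_norm] at hz
      rw [hz]; exact hr.ne'
    simp [poissonKernel_def, hz0]
  · intro z hz
    rw [abs_of_pos hr] at hz
    exact (hHre _ (hm (sphere_subset_closedBall hz))).symm

/-- **Littlewood's subordination principle** for a function below its Poisson integral. -/
theorem circleAverage_comp_le {r R : ℝ} {u : ℂ → ℝ} {ω : ℂ → ℂ} (hr : 0 < r) (hrR : r < R)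
    (hu : ContinuousOn u (closedBall 0 r)) (hω : DifferentiableOn ℂ ω (ball 0 R)) (h0 : ω 0 = 0)
    (hm : MapsTo ω (closedBall 0 r) (ball 0 r))
    (hsub : ∀ w ∈ ball (0 : ℂ) r, u w ≤ poissonMean r u w) :
    circleAverage (fun z => u (ω z)) 0 r ≤ circleAverage u 0 r ∧
      ((∀ w ∈ ball (0 : ℂ) r, u w < poissonMean r u w) →
        circleAverage (fun z => u (ω z)) 0 r < circleAverage u 0 r) := by
  have hus : ContinuousOn u (sphere 0 r) := hu.mono sphere_subset_closedBall
  have hms : ∀ z ∈ sphere (0 : ℂ) r, ω z ∈ ball (0 : ℂ) r := fun z hz =>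
    hm (sphere_subset_closedBall hz)
  have hωc : ContinuousOn ω (sphere 0 r) :=
    hω.continuousOn.mono (sphere_subset_closedBall.trans (closedBall_subset_ball hrR))
  have hc1 : ContinuousOn (fun z => u (ω z)) (sphere 0 r) :=
    hu.comp hωc fun z hz => ball_subset_closedBall (hms z hz)
  have huci : CircleIntegrable (fun ζ => (u ζ : ℂ)) 0 r :=
    (Complex.continuous_ofReal.comp_continuousOn hus).circleIntegrable hr.le
  have hc2 : ContinuousOn (poissonMean r u) (ball 0 r) := by
    refine (Complex.continuous_re.comp_continuousOn
      (differentiableOn_circleAverage_herglotzRieszKernel_smul huci).continuousOn).congr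
      fun w hw => ?_
    rw [poissonMean, poissonKernel_eq_re_herglotzRieszKernel]
    exact (re_circleAverage_herglotzRieszKernel_smul (hus.circleIntegrable hr.le) hw).symm
  have hc3 : ContinuousOn (fun z => poissonMean r u (ω z)) (sphere 0 r) := hc2.comp hωc hms
  rw [← circleAverage_poissonMean_comp hr hrR hus hω h0 hm]
  refine ⟨circleAverage_mono (hc1.circleIntegrable hr.le) (hc3.circleIntegrable hr.le)
    fun z hz => ?_, fun hlt => ?_⟩
  · rw [abs_of_pos hr] at hz
    exact hsub _ (hms z hz)
  -- Every point of the circle is sent into the open disk, so the inequality is strict everywhere;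
  -- the point `r` serves as witness.
  · exact circleAverage_lt_circleAverage hr hc1 hc3 (fun z hz => (hlt _ (hms z hz)).le)
      ⟨r, by simp [abs_of_pos hr], hlt _ (hms _ (by simp [abs_of_pos hr]))⟩

/-! ### Strict sub-mean value inequalities -/

theorem exists_subgradient {Ψ : ℝ → ℝ} (hΨ : ConvexOn ℝ univ Ψ) (m : ℝ) :
    ∃ a, ∀ t, Ψ m + a * (t - m) ≤ Ψ t := by
  have hm : m ∈ interior (univ : Set ℝ) := by simp
  refine ⟨derivWithin Ψ (Ioi m) m, fun t => ?_⟩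
  rcases lt_trichotomy t m with h | rfl | h
  · have h1 := hΨ.slope_le_leftDeriv_of_mem_interior (mem_univ t) hm h
    have h2 := hΨ.leftDeriv_le_rightDeriv_of_mem_interior hm
    have h3 := h1.trans h2
    rw [slope_def_field, div_le_iff₀ (by linarith)] at h3
    linarith
  · simp
  · have h1 := hΨ.rightDeriv_le_slope_of_mem_interior hm (mem_univ t) h
    rw [slope_def_field, le_div_iff₀ (by linarith)] at h1
    linarith

/-- Jensen's inequality for the Poisson kernel, with its equality case. -/
theorem le_poissonMean_convex {r : ℝ} {w : ℂ} {Ψ : ℝ → ℝ} {L : ℂ → ℂ} (hΨc : Continuous Ψ)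
    (hΨ : ConvexOn ℝ univ Ψ) (hr : 0 < r) (hw : w ∈ ball (0 : ℂ) r)
    (hL : DiffContOnCl ℂ L (ball 0 r)) :
    Ψ (L w).re ≤ poissonMean r (fun z => Ψ (L z).re) w ∧
      ((¬ ∃ a b : ℝ, ∀ z ∈ sphere (0 : ℂ) r, Ψ (L z).re = a * (L z).re + b) →
        Ψ (L w).re < poissonMean r (fun z => Ψ (L z).re) w) := by
  obtain ⟨a, ha⟩ := exists_subgradient hΨ (L w).re
  have hc : ContinuousOn (fun z => (L z).re) (sphere 0 r) :=
    Complex.continuous_re.comp_continuousOn (hL.continuousOn.mono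
      (by rw [closure_ball _ hr.ne']; exact sphere_subset_closedBall))
  -- The line `a t + b` supports `Ψ` at `Re L(w)`. The Poisson integral reproduces `a Re L + b`, so
  -- the Jensen gap is the Poisson integral of a nonnegative continuous function and vanishes only
  -- if `Ψ` is affine on the values taken on the circle.
  set b := Ψ (L w).re - a * (L w).re with hb
  have hcΨ : ContinuousOn (fun z => Ψ (L z).re) (sphere 0 r) := hΨc.comp_continuousOn hc
  have hca : ContinuousOn (fun z => a * (L z).re) (sphere 0 r) := continuousOn_const.mul hc
  have hP : poissonMean r ((fun z => Ψ (L z).re) - (fun z => a * (L z).re) - fun _ => b) w =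
      poissonMean r (fun z => Ψ (L z).re) w - Ψ (L w).re := by
    rw [poissonMean_sub hr hw (hcΨ.sub hca) continuousOn_const, poissonMean_sub hr hw hcΨ hca,
      poissonMean_const_mul, poissonMean_re hr hw hL, poissonMean_const hr hw, hb]
    ring
  have hnn : ∀ z : ℂ,
      0 ≤ ((fun z => Ψ (L z).re) - (fun z => a * (L z).re) - fun _ => b : ℂ → ℝ) z := by
    intro z
    have := ha (L z).re
    simp only [Pi.sub_apply, hb]
    linarith
  constructor
  · have := poissonMean_nonneg hr hw fun z _ => hnn z
    rw [hP] at this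
    linarith
  · intro hne
    have := poissonMean_pos (u := (fun z => Ψ (L z).re) - (fun z => a * (L z).re) - fun _ => b)
      hr hw ((hcΨ.sub hca).sub continuousOn_const) (fun z _ => hnn z) (by
      by_contra! hcon
      refine hne ⟨a, b, fun z hz => ?_⟩
      have := le_antisymm (hcon z hz) (hnn z)
      simp only [Pi.sub_apply] at this
      linarith)
    rw [hP] at this
    linarith

/-- Multiply `H` by a unimodular constant that makes its value at `w` nonnegative, then use the
Poisson formula and `Re ≤ |·|`. -/
theorem norm_le_poissonMean {r : ℝ} {w : ℂ} {H : ℂ → ℂ} (hr : 0 < r) (hw : w ∈ ball (0 : ℂ) r)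
    (hH : DiffContOnCl ℂ H (ball 0 r)) : ‖H w‖ ≤ poissonMean r (fun z => ‖H z‖) w := by
  obtain ⟨c, hc, hcH⟩ : ∃ c : ℂ, ‖c‖ = 1 ∧ (c * H w).re = ‖H w‖ := by
    by_cases h : H w = 0
    · exact ⟨1, by simp, by simp [h]⟩
    · have hn : (‖H w‖ : ℂ) ≠ 0 := by exact_mod_cast norm_ne_zero_iff.2 h
      refine ⟨conj (H w) / ‖H w‖, by simp [h], ?_⟩
      have h1 : conj (H w) / ‖H w‖ * H w = (‖H w‖ : ℂ) := by
        rw [div_mul_eq_mul_div, mul_comm, Complex.mul_conj, Complex.normSq_eq_norm_sq]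
        push_cast
        field_simp
      rw [h1, Complex.ofReal_re]
  have hHc : ContinuousOn H (sphere 0 r) :=
    hH.continuousOn.mono (by rw [closure_ball _ hr.ne']; exact sphere_subset_closedBall)
  have hd : DiffContOnCl ℂ (fun z => c * H z) (ball 0 r) := hH.const_smul c
  have h1 := poissonMean_re hr hw hd
  have h2 := poissonMean_sub hr hw hHc.norm
    (Complex.continuous_re.comp_continuousOn (continuousOn_const.mul hHc : ContinuousOn
      (fun z => c * H z) (sphere 0 r)))
  have h3 := poissonMean_nonneg (u := (fun z => ‖H z‖) - fun z => (c * H z).re) hr hw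
    fun z _ => by
      have := Complex.re_le_norm (c * H z)
      rw [norm_mul, hc, one_mul] at this
      simpa using this
  have h4 : poissonMean r ((fun z => ‖H z‖) - fun z => (c * H z).re) w =
    poissonMean r (fun z => ‖H z‖) w - poissonMean r (fun z => (c * H z).re) w := h2
  rw [h4, h1, hcH] at h3
  linarith

/-- Factor `|K|^p = |z|^p |exp(p L)|`. The second factor is below its Poisson integral for every `p
> 0`, while `|z|^p` is the constant `r^p` on the circle and strictly smaller inside. This is where
the absence of other zeros of `K` matters. -/
theorem norm_rpow_lt_poissonMean {r p : ℝ} {w : ℂ} {K L : ℂ → ℂ} (hr : 0 < r)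
    (hw : w ∈ ball (0 : ℂ) r) (hp : 0 < p) (hL : DiffContOnCl ℂ L (ball 0 r))
    (hK : ∀ z, z ∈ closedBall (0 : ℂ) r → K z = z * Complex.exp (L z)) :
    ‖K w‖ ^ p < poissonMean r (fun z => ‖K z‖ ^ p) w := by
  have hd : DiffContOnCl ℂ (fun z => (p : ℂ) * L z) (ball 0 r) := hL.const_smul (p : ℂ)
  have hHd : DiffContOnCl ℂ (fun z => Complex.exp ((p : ℂ) * L z)) (ball 0 r) :=
    Complex.differentiable_exp.comp_diffContOnCl hd
  have hKp : ∀ z ∈ closedBall (0 : ℂ) r, ‖K z‖ ^ p = ‖z‖ ^ p * ‖Complex.exp ((p : ℂ) * L z)‖ := by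
    intro z hz
    rw [hK z hz, norm_mul, Real.mul_rpow (norm_nonneg _) (norm_nonneg _), Complex.norm_exp,
      Complex.norm_exp, ← Real.exp_mul]
    congr 2
    simp [mul_comm]
  rw [hKp w (ball_subset_closedBall hw), poissonMean_congr hr (v := fun z => r ^ p *
    ‖Complex.exp ((p : ℂ) * L z)‖) (fun z hz => by
      rw [hKp z (sphere_subset_closedBall hz), mem_sphere_zero_iff_norm.1 hz]),
    poissonMean_const_mul]
  have h1 : ‖w‖ ^ p < r ^ p := Real.rpow_lt_rpow (norm_nonneg _) (mem_ball_zero_iff.1 hw) hp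
  have h2 := norm_le_poissonMean hr hw hHd
  have h3 : 0 < ‖Complex.exp ((p : ℂ) * L w)‖ := norm_pos_iff.2 (Complex.exp_ne_zero _)
  calc _ < r ^ p * ‖Complex.exp ((p : ℂ) * L w)‖ := mul_lt_mul_of_pos_right h1 h3
    _ ≤ _ := mul_le_mul_of_nonneg_left h2 (by positivity)

/-! ### Integrals over the circle, rotations and extended real means -/

theorem integral_circleMap_eq (u : ℂ → ℝ) (r : ℝ) :
    ∫ θ in (-π)..π, u (circleMap 0 r θ) = 2 * π * circleAverage u 0 r := by
  have hp : (fun θ => u (circleMap 0 r θ)).Periodic (2 * π) :=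
    fun x => by simp [periodic_circleMap 0 r x]
  have h := hp.intervalIntegral_add_eq (-π) 0
  rw [show -π + 2 * π = π by ring, zero_add] at h
  rw [h, Real.circleAverage, smul_eq_mul]
  field_simp

/-- Circle averages are invariant under rotation. -/
theorem integral_circleMap_rotate {E : Type*} [NormedAddCommGroup E] [NormedSpace ℝ E]
    (u : ℂ → E) (r : ℝ) {ε : ℂ} (hε : ‖ε‖ = 1) :
    ∫ θ in (-π)..π, u (ε * circleMap 0 r θ) = ∫ θ in (-π)..π, u (circleMap 0 r θ) := by
  have hp : (fun θ => u (circleMap 0 r θ)).Periodic (2 * π) :=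
    fun x => by simp [periodic_circleMap 0 r x]
  have hε' : ∀ θ : ℝ, ε * circleMap 0 r θ = circleMap 0 r (θ + ε.arg) := fun θ => by
    have h1 : ε = Complex.exp (ε.arg * Complex.I) := by
      simpa [hε] using (Complex.norm_mul_exp_arg_mul_I ε).symm
    conv_lhs => rw [h1]
    simp only [circleMap, zero_add]
    push_cast
    rw [add_mul, Complex.exp_add]
    ring
  simp_rw [hε']
  rw [intervalIntegral.integral_comp_add_right (fun θ => u (circleMap 0 r θ))]
  have h := hp.intervalIntegral_add_eq (-π) (-π + ε.arg)
  rw [show -π + 2 * π = π by ring, show -π + ε.arg + 2 * π = π + ε.arg by ring] at h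
  exact h.symm

theorem exists_log_of_ne_zero {G : ℂ → ℂ} (hG : DifferentiableOn ℂ G (ball 0 1))
    (hne : ∀ z ∈ ball (0 : ℂ) 1, G z ≠ 0) :
    ∃ L : ℂ → ℂ, DifferentiableOn ℂ L (ball 0 1) ∧ ∀ z ∈ ball (0 : ℂ) 1, G z = Complex.exp (L z) := by
  have h0 : (0 : ℂ) ∈ ball (0 : ℂ) 1 := by simp
  obtain ⟨P, hP⟩ := ((hG.deriv isOpen_ball).div hG hne).isExactOn_ball
  have hPd : DifferentiableOn ℂ P (ball 0 1) := fun z hz =>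
    (hP z hz).differentiableAt.differentiableWithinAt
  have hE : DifferentiableOn ℂ (fun z => G z * Complex.exp (-P z)) (ball 0 1) :=
    hG.mul hPd.neg.cexp
  have hder : EqOn (deriv fun z => G z * Complex.exp (-P z)) 0 (ball 0 1) := fun z hz => by
    have h1 := (hG.differentiableAt (isOpen_ball.mem_nhds hz)).hasDerivAt.mul (hP z hz).neg.cexp
    have h2 : HasDerivAt (fun z => G z * Complex.exp (-P z)) _ z := h1
    rw [h2.deriv, Pi.div_apply]
    have := hne z hz
    simp only [Pi.neg_apply, Pi.zero_apply]
    field_simp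
    ring
  obtain ⟨c, hc⟩ := isOpen_ball.exists_is_const_of_deriv_eq_zero
    (convex_ball (0 : ℂ) 1).isPreconnected hE hder
  have hc0 : c ≠ 0 := by
    rw [← hc 0 h0]
    exact mul_ne_zero (hne 0 h0) (Complex.exp_ne_zero _)
  refine ⟨fun z => P z + Complex.log c, hPd.add_const _, fun z hz => ?_⟩
  rw [Complex.exp_add, Complex.exp_log hc0, ← hc z hz, mul_left_comm, ← Complex.exp_add]
  simp

theorem circleAverage_re {r : ℝ} {L : ℂ → ℂ} (hr : 0 < r) (hL : DiffContOnCl ℂ L (ball 0 r)) :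
    circleAverage (fun z => (L z).re) 0 r = (L 0).re := by
  have hc : CircleIntegrable L 0 r := (hL.continuousOn.mono
    (by rw [closure_ball _ hr.ne']; exact sphere_subset_closedBall)).circleIntegrable hr.le
  have h1 := Complex.reCLM.circleAverage_comp_comm hc
  rw [Complex.reCLM_apply, DiffContOnCl.circleAverage (by rwa [abs_of_pos hr])] at h1
  exact h1

theorem erealMean_mono {g h : ℝ → EReal} (hgh : ∀ θ, g θ ≤ h θ) : erealMean g ≤ erealMean h := by
  refine EReal.sub_le_sub ?_ ?_
  · exact EReal.coe_ennreal_le_coe_ennreal_iff.2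
      (lintegral_mono fun θ => EReal.toENNReal_le_toENNReal (hgh θ))
  · exact EReal.coe_ennreal_le_coe_ennreal_iff.2
      (lintegral_mono fun θ => EReal.toENNReal_le_toENNReal (EReal.neg_le_neg_iff.2 (hgh θ)))

theorem erealMean_coe {h : ℝ → ℝ} (hh : Continuous h) :
    erealMean (fun θ => (h θ : EReal)) = ((∫ θ in (-π)..π, h θ : ℝ) : EReal) := by
  have hi : IntegrableOn h (Icc (-π) π) := hh.continuousOn.integrableOn_Icc
  have h1 := hi.lintegral_lt_top
  have h2 : ∫⁻ θ in Icc (-π) π, ENNReal.ofReal (-h θ) < ⊤ := hi.neg.lintegral_lt_top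
  rw [intervalIntegral.integral_of_le (by linarith [pi_pos]), ← integral_Icc_eq_integral_Ioc,
    integral_eq_lintegral_pos_part_sub_lintegral_neg_part hi, erealMean, EReal.coe_sub,
    EReal.coe_ennreal_toReal h1.ne, EReal.coe_ennreal_toReal h2.ne]
  rfl

theorem log_enorm_eq {w : ℂ} (hw : w ≠ 0) : ENNReal.log ‖w‖ₑ = (Real.log ‖w‖ : EReal) := by
  rw [← ofReal_norm, ENNReal.log_ofReal_of_pos (norm_pos_iff.2 hw)]

/-- Since `K` has no zeros on the circle, both means are ordinary integrals of continuous functions,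
to which rotation invariance applies. -/
theorem erealMean_log_rotate {r : ℝ} {K : ℂ → ℂ} {ε : ℂ} (hr : 0 < r) (hr1 : r < 1)
    (hK : ContinuousOn K (ball 0 1)) (hne : ∀ z ∈ ball (0 : ℂ) 1, z ≠ 0 → K z ≠ 0)
    (hε : ‖ε‖ = 1) :
    erealMean (fun θ => ENNReal.log ‖K (ε * circleMap 0 r θ)‖ₑ) =
      erealMean (fun θ => ENNReal.log ‖K (circleMap 0 r θ)‖ₑ) := by
  have key : ∀ δ : ℂ, ‖δ‖ = 1 → erealMean (fun θ => ENNReal.log ‖K (δ * circleMap 0 r θ)‖ₑ) =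
      ((∫ θ in (-π)..π, Real.log ‖K (δ * circleMap 0 r θ)‖ : ℝ) : EReal) := fun δ hδ => by
    have hn : ∀ θ : ℝ, ‖δ * circleMap 0 r θ‖ = r := fun θ => by
      rw [norm_mul, hδ, norm_circleMap_zero, abs_of_pos hr, one_mul]
    have hmem : ∀ θ : ℝ, δ * circleMap 0 r θ ∈ ball (0 : ℂ) 1 := fun θ => by
      rw [mem_ball_zero_iff, hn]; exact hr1
    have hne' : ∀ θ : ℝ, K (δ * circleMap 0 r θ) ≠ 0 := fun θ =>
      hne _ (hmem θ) (norm_pos_iff.1 (by rw [hn]; exact hr))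
    rw [← erealMean_coe]
    · simp only [log_enorm_eq (hne' _)]
    · exact (hK.comp_continuous (by fun_prop) hmem).norm.log fun θ => norm_ne_zero_iff.2 (hne' θ)
  have h1 := key 1 norm_one
  simp only [one_mul] at h1
  rw [key ε hε, h1, integral_circleMap_rotate (fun z => Real.log ‖K z‖) r hε]

/-! ### Comparison of the means under subordination -/

/-- A subordination that is not a rotation strictly decreases the logarithmic mean. -/
theorem erealMean_log_lt {r R : ℝ} {K L F ω : ℂ → ℂ} (hr : 0 < r) (hrR : r < R) (hR : R < 1)
    (hL : DifferentiableOn ℂ L (ball 0 1))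
    (hKL : ∀ z ∈ ball (0 : ℂ) 1, K z = z * Complex.exp (L z)) (hω : IsDiskLift K F R ω)
    (hm : MapsTo ω (closedBall 0 r) (ball 0 r)) :
    erealMean (fun θ => ENNReal.log ‖F (circleMap 0 r θ)‖ₑ) <
      erealMean (fun θ => ENNReal.log ‖K (circleMap 0 r θ)‖ₑ) := by
  have hr1 : closedBall (0 : ℂ) r ⊆ ball 0 1 := closedBall_subset_ball (by linarith)
  have hrR' : closedBall (0 : ℂ) r ⊆ ball 0 R := closedBall_subset_ball hrR
  have hcm : ∀ θ : ℝ, circleMap 0 r θ ∈ closedBall (0 : ℂ) r := circleMap_mem_closedBall 0 hr.le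
  have hωc : ContinuousOn ω (closedBall 0 r) := hω.diff.continuousOn.mono hrR'
  obtain ⟨z₀, hz₀, hmax⟩ := (isCompact_closedBall (0 : ℂ) r).exists_isMaxOn
    ⟨0, mem_closedBall_self hr.le⟩ hωc.norm
  -- On the circle, `log |K| = log r + Re L` and `log |F| ≤ log c + Re (L ∘ ω)`. Replacing `|ω|` by
  -- a constant `c < r` leaves a harmonic majorant even where `F` vanishes. Both right-hand sides
  -- have computable means, and these differ by `log r - log c`.
  obtain ⟨c, hc1, hc2⟩ := exists_between (mem_ball_zero_iff.1 (hm hz₀))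
  have hc0 : 0 < c := (norm_nonneg _).trans_lt hc1
  have hd1 : DiffContOnCl ℂ (fun z => (Real.log r : ℂ) + L z) (ball 0 r) :=
    DifferentiableOn.diffContOnCl_ball (hL.const_add _) hr1
  have hd2 : DiffContOnCl ℂ (fun z => (Real.log c : ℂ) + L (ω z)) (ball 0 r) :=
    DifferentiableOn.diffContOnCl_ball ((hL.comp hω.diff hω.mapsTo).const_add _) hrR'
  have hcont : ∀ {g : ℂ → ℂ}, DiffContOnCl ℂ g (ball 0 r) →
      Continuous fun θ : ℝ => (g (circleMap 0 r θ)).re := fun hg => by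
    have := hg.continuousOn
    rw [closure_ball _ hr.ne'] at this
    exact Complex.continuous_re.comp (this.comp_continuous (continuous_circleMap 0 r) hcm)
  have hK : (fun θ : ℝ => ENNReal.log ‖K (circleMap 0 r θ)‖ₑ) =
      fun θ => (((Real.log r : ℂ) + L (circleMap 0 r θ)).re : EReal) := by
    ext θ
    have hne : circleMap 0 r θ ≠ 0 := by
      rw [← norm_pos_iff]; simpa using hr.ne'
    rw [hKL _ (hr1 (hcm θ)), log_enorm_eq (mul_ne_zero hne (Complex.exp_ne_zero _)), norm_mul,
      Real.log_mul (norm_ne_zero_iff.2 hne) (norm_ne_zero_iff.2 (Complex.exp_ne_zero _)),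
      Complex.norm_exp, Real.log_exp, norm_circleMap_zero, abs_of_pos hr]
    simp
  have hF : ∀ θ : ℝ, ENNReal.log ‖F (circleMap 0 r θ)‖ₑ ≤
      (((Real.log c : ℂ) + L (ω (circleMap 0 r θ))).re : EReal) := fun θ => by
    rw [← hω.lift _ (hrR' (hcm θ)), hKL _ (hω.mapsTo (hrR' (hcm θ)))]
    by_cases hne : ω (circleMap 0 r θ) = 0
    · simp [hne]
    · rw [log_enorm_eq (mul_ne_zero hne (Complex.exp_ne_zero _)), norm_mul,
        Real.log_mul (norm_ne_zero_iff.2 hne) (norm_ne_zero_iff.2 (Complex.exp_ne_zero _)),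
        Complex.norm_exp, Real.log_exp, EReal.coe_le_coe_iff, Complex.add_re, Complex.ofReal_re]
      have h1 : ‖ω (circleMap 0 r θ)‖ ≤ c := (hmax (hcm θ)).trans hc1.le
      have h2 := Real.log_le_log (norm_pos_iff.2 hne) h1
      linarith
  refine (erealMean_mono hF).trans_lt ?_
  rw [hK, erealMean_coe (hcont hd1), erealMean_coe (hcont hd2), EReal.coe_lt_coe_iff,
    integral_circleMap_eq (fun z => ((Real.log r : ℂ) + L z).re),
    integral_circleMap_eq (fun z => ((Real.log c : ℂ) + L (ω z)).re), circleAverage_re hr hd1,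
    circleAverage_re hr hd2, hω.map_zero]
  refine mul_lt_mul_of_pos_left ?_ (by positivity)
  simpa using Real.log_lt_log hc0 hc2

/-- A subordination that is not a rotation strictly decreases the means of order `p`. -/
theorem integral_norm_rpow_lt {r R p : ℝ} {K L F ω : ℂ → ℂ} (hr : 0 < r) (hrR : r < R) (hR : R < 1)
    (hp : 0 < p) (hK : DifferentiableOn ℂ K (ball 0 1)) (hL : DifferentiableOn ℂ L (ball 0 1))
    (hKL : ∀ z ∈ ball (0 : ℂ) 1, K z = z * Complex.exp (L z)) (hω : IsDiskLift K F R ω)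
    (hm : MapsTo ω (closedBall 0 r) (ball 0 r)) :
    ∫ θ in (-π)..π, ‖F (circleMap 0 r θ)‖ ^ p < ∫ θ in (-π)..π, ‖K (circleMap 0 r θ)‖ ^ p := by
  have hr1 : closedBall (0 : ℂ) r ⊆ ball 0 1 := closedBall_subset_ball (by linarith)
  have hrR' : closedBall (0 : ℂ) r ⊆ ball 0 R := closedBall_subset_ball hrR
  have hu : ContinuousOn (fun z => ‖K z‖ ^ p) (closedBall 0 r) :=
    (hK.continuousOn.mono hr1).norm.rpow_const fun _ _ => Or.inr hp.le
  have hlt : ∀ w ∈ ball (0 : ℂ) r, ‖K w‖ ^ p < poissonMean r (fun z => ‖K z‖ ^ p) w :=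
    fun w hw => norm_rpow_lt_poissonMean hr hw hp (DifferentiableOn.diffContOnCl_ball hL hr1)
      fun z hz => hKL z (hr1 hz)
  have h := (circleAverage_comp_le hr hrR hu hω.diff hω.map_zero hm fun w hw => (hlt w hw).le).2 hlt
  rw [integral_circleMap_eq (fun z => ‖F z‖ ^ p), integral_circleMap_eq (fun z => ‖K z‖ ^ p)]
  refine mul_lt_mul_of_pos_left ?_ (by positivity)
  refine lt_of_eq_of_lt (circleAverage_congr_sphere fun z hz => ?_) h
  rw [abs_of_pos hr] at hz
  simp only [hω.lift z (hrR' (sphere_subset_closedBall hz))]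

/-- A subordination decreases convex means of real parts, strictly unless it is a rotation or
the convex function is affine on the relevant range. -/
theorem integral_convex_re_le {r R : ℝ} {c : ℂ} {Ψ : ℝ → ℝ} {K F ω : ℂ → ℂ} (hΨc : Continuous Ψ)
    (hΨ : ConvexOn ℝ univ Ψ) (hr : 0 < r) (hrR : r < R) (hR : R < 1)
    (hK : DifferentiableOn ℂ K (ball 0 1)) (hω : IsDiskLift K F R ω)
    (hm : MapsTo ω (closedBall 0 r) (ball 0 r)) :
    ∫ θ in (-π)..π, Ψ (c * F (circleMap 0 r θ)).re ≤
        ∫ θ in (-π)..π, Ψ (c * K (circleMap 0 r θ)).re ∧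
      (¬ IsLinearOn Ψ (circleRange (fun z => (c * K z).re) r) →
        ∫ θ in (-π)..π, Ψ (c * F (circleMap 0 r θ)).re <
          ∫ θ in (-π)..π, Ψ (c * K (circleMap 0 r θ)).re) := by
  have hr1 : closedBall (0 : ℂ) r ⊆ ball 0 1 := closedBall_subset_ball (by linarith)
  have hrR' : closedBall (0 : ℂ) r ⊆ ball 0 R := closedBall_subset_ball hrR
  have hd : DiffContOnCl ℂ (fun z => c * K z) (ball 0 r) :=
    DifferentiableOn.diffContOnCl_ball (hK.const_mul c) hr1
  have hre : ContinuousOn (fun z => (c * K z).re) (closedBall 0 r) :=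
    Complex.continuous_re.comp_continuousOn ((hK.const_mul c).continuousOn.mono hr1)
  have h := circleAverage_comp_le hr hrR (hΨc.comp_continuousOn hre) hω.diff hω.map_zero hm
    fun w hw => (le_poissonMean_convex hΨc hΨ hr hw hd).1
  have hFK : circleAverage (fun z => Ψ (c * F z).re) 0 r =
      circleAverage (fun z => Ψ (c * K (ω z)).re) 0 r :=
    circleAverage_congr_sphere fun z hz => by
      rw [abs_of_pos hr] at hz
      simp only [hω.lift z (hrR' (sphere_subset_closedBall hz))]
  rw [integral_circleMap_eq (fun z => Ψ (c * F z).re), integral_circleMap_eq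
    (fun z => Ψ (c * K z).re), hFK]
  refine ⟨mul_le_mul_of_nonneg_left h.1 (by positivity), fun hlin =>
    mul_lt_mul_of_pos_left (h.2 fun w hw => (le_poissonMean_convex hΨc hΨ hr hw hd).2 ?_)
      (by positivity)⟩
  -- By the intermediate value theorem, the values on the circle fill the closed interval from
  -- minimum to maximum, so affinity on them contradicts the hypothesis on `circleRange`.
  rintro ⟨a, b, hab⟩
  refine hlin ⟨a, b, fun t ht => ?_⟩
  have hcont : ContinuousOn (fun θ : ℝ => (c * K (circleMap 0 r θ)).re) (Icc (-π) π) :=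
    (hre.comp_continuous (continuous_circleMap 0 r)
      (circleMap_mem_closedBall 0 hr.le)).continuousOn
  have himg := hcont.image_Icc (by linarith [pi_pos])
  have ht' := Ioo_subset_Icc_self ht
  rw [← himg] at ht'
  obtain ⟨θ, -, rfl⟩ := ht'
  exact hab _ (circleMap_mem_sphere 0 hr.le θ)

/-! ### The extremal function and the subordination of `log f'` -/

theorem MemC.hasDerivAt_logDer {Ω : Set ℂ} {f : ℂ → ℂ} (hf : MemC Ω f) {z : ℂ}
    (hz : z ∈ ball (0 : ℂ) 1) : HasDerivAt (logDer f) (deriv (deriv f) z / deriv f z) z := by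
  have hd := hf.holomorphic.deriv isOpen_ball
  have hq := (hd.deriv isOpen_ball).div hd hf.deriv_ne_zero
  obtain ⟨G, hG⟩ := hq.isExactOn_ball
  refine ((hG z hz).sub_const (G 0)).congr_of_eventuallyEq ?_
  filter_upwards [isOpen_ball.mem_nhds hz] with y hy
  exact segIntegral_eq_sub hq.continuousOn hG hy

section Extremal

variable {Ω : Set ℂ} {φ : ℂ → ℂ}

theorem IsNormalizedConformalMap.differentiableOn_dslope (hφ : IsNormalizedConformalMap Ω φ) :
    DifferentiableOn ℂ (dslope φ 0) (ball 0 1) :=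
  (Complex.differentiableOn_dslope (isOpen_ball.mem_nhds (by simp))).2 hφ.holomorphic

theorem IsNormalizedConformalMap.mul_dslope (hφ : IsNormalizedConformalMap Ω φ) (z : ℂ) :
    z * dslope φ 0 z = φ z - 1 := by
  simpa [hφ.map_zero] using sub_smul_dslope φ 0 z

theorem IsNormalizedConformalMap.dslope_ne_zero (hφ : IsNormalizedConformalMap Ω φ) {z : ℂ}
    (hz : z ∈ ball (0 : ℂ) 1) : dslope φ 0 z ≠ 0 := by
  intro h
  by_cases hz0 : z = 0
  · rw [hz0, dslope_same] at h
    have := hφ.deriv_pos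
    simp [h] at this
  · have h1 := hφ.mul_dslope z
    rw [h, mul_zero] at h1
    refine hz0 (hφ.bijective.injOn hz (by simp [unitDisk]) ?_)
    rw [hφ.map_zero]
    exact (sub_eq_zero.1 h1.symm)

theorem IsNormalizedConformalMap.hasDerivAt_segIntegral (hφ : IsNormalizedConformalMap Ω φ) {z : ℂ}
    (hz : z ∈ ball (0 : ℂ) 1) :
    HasDerivAt (segIntegral fun ζ => (φ ζ - 1) / ζ) (dslope φ 0 z) z := by
  obtain ⟨G, hG⟩ := hφ.differentiableOn_dslope.isExactOn_ball
  -- At `ζ = 0` the quotient takes the default value `0`, while `dslope` takes `φ'(0)`. On the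
  -- segment this affects a single parameter, so the integrals agree.
  have hseg : ∀ y, segIntegral (fun ζ => (φ ζ - 1) / ζ) y = segIntegral (dslope φ 0) y := by
    intro y
    refine intervalIntegral.integral_congr_ae (ae_of_all _ fun t ht => ?_)
    rw [uIoc_of_le zero_le_one] at ht
    by_cases hy : y = 0
    · simp [hy]
    · have hty : (t : ℂ) * y ≠ 0 := mul_ne_zero (by exact_mod_cast ht.1.ne') hy
      simp only
      rw [← hφ.mul_dslope, mul_div_cancel_left₀ _ hty]
  refine ((hG z hz).sub_const (G 0)).congr_of_eventuallyEq ?_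
  filter_upwards [isOpen_ball.mem_nhds hz] with y hy
  rw [hseg]
  exact segIntegral_eq_sub hφ.differentiableOn_dslope.continuousOn hG hy

theorem segIntegral_zero (g : ℂ → ℂ) : segIntegral g 0 = 0 := by simp [segIntegral]

theorem IsNormalizedConformalMap.hasDerivAt_kFun (hφ : IsNormalizedConformalMap Ω φ) {z : ℂ}
    (hz : z ∈ ball (0 : ℂ) 1) :
    HasDerivAt (kFun φ) (Complex.exp (segIntegral (fun ζ => (φ ζ - 1) / ζ) z)) z := by
  have hd : DifferentiableOn ℂ
      (fun z => Complex.exp (segIntegral (fun ζ => (φ ζ - 1) / ζ) z)) (ball 0 1) :=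
    fun y hy => (hφ.hasDerivAt_segIntegral hy).cexp.differentiableAt.differentiableWithinAt
  obtain ⟨G, hG⟩ := hd.isExactOn_ball
  refine ((hG z hz).sub_const (G 0)).congr_of_eventuallyEq ?_
  filter_upwards [isOpen_ball.mem_nhds hz] with y hy
  exact segIntegral_eq_sub hd.continuousOn hG hy

theorem IsNormalizedConformalMap.deriv_deriv_kFun (hφ : IsNormalizedConformalMap Ω φ) {z : ℂ}
    (hz : z ∈ ball (0 : ℂ) 1) : deriv (deriv (kFun φ)) z / deriv (kFun φ) z = dslope φ 0 z := by
  have h1 : deriv (kFun φ) =ᶠ[𝓝 z]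
      fun y => Complex.exp (segIntegral (fun ζ => (φ ζ - 1) / ζ) y) := by
    filter_upwards [isOpen_ball.mem_nhds hz] with y hy using (hφ.hasDerivAt_kFun hy).deriv
  rw [h1.deriv_eq, h1.self_of_nhds, (hφ.hasDerivAt_segIntegral hz).cexp.deriv,
    mul_div_cancel_left₀ _ (Complex.exp_ne_zero _)]

/-- The extremal function `k_Ω` belongs to the class `C(Ω)`. -/
theorem IsNormalizedConformalMap.memC_kFun (hφ : IsNormalizedConformalMap Ω φ) :
    MemC Ω (kFun φ) where
  holomorphic := fun z hz => (hφ.hasDerivAt_kFun hz).differentiableAt.differentiableWithinAt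
  map_zero := segIntegral_zero _
  deriv_zero := by
    rw [(hφ.hasDerivAt_kFun (by simp)).deriv, segIntegral_zero, Complex.exp_zero]
  deriv_ne_zero := fun z hz => by
    rw [(hφ.hasDerivAt_kFun hz).deriv]
    exact Complex.exp_ne_zero _
  mem := fun z hz => by
    rw [mul_div_assoc, hφ.deriv_deriv_kFun hz, hφ.mul_dslope, add_sub_cancel]
    exact hφ.bijective.mapsTo hz

end Extremal

theorem mul_mem_ball {ε z : ℂ} (hε : ‖ε‖ = 1) (hz : z ∈ ball (0 : ℂ) 1) :
    ε * z ∈ ball (0 : ℂ) 1 := by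
  rw [mem_ball_zero_iff] at hz ⊢
  rwa [norm_mul, hε, one_mul]

/-- Differentiating `f(z) = conj(ε) k(ε z)` gives `f'(z) = k'(ε z)`, and both logarithms vanish at
`0`. Conversely, exponentiate and integrate from `0`. The same `ε` serves on both sides. -/
theorem isRotationOf_iff {Ω : Set ℂ} {f k : ℂ → ℂ} (hf : MemC Ω f) (hk : MemC Ω k) :
    IsRotationOf k f ↔
      ∃ ε : ℂ, ‖ε‖ = 1 ∧ ∀ z ∈ ball (0 : ℂ) 1, logDer f z = logDer k (ε * z) := by
  have hpre : IsPreconnected (ball (0 : ℂ) 1) := (convex_ball 0 1).isPreconnected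
  have h00 : (0 : ℂ) ∈ ball (0 : ℂ) 1 := by simp
  have hmul : ∀ {g : ℂ → ℂ} {g' ε z : ℂ}, HasDerivAt g g' (ε * z) →
      HasDerivAt (fun z => g (ε * z)) (g' * ε) z := fun {g g' ε z} hg =>
    hg.comp z (by simpa using (hasDerivAt_id z).const_mul ε)
  have hkd : ∀ y ∈ ball (0 : ℂ) 1, HasDerivAt k (deriv k y) y := fun y hy =>
    (hk.holomorphic.differentiableAt (isOpen_ball.mem_nhds hy)).hasDerivAt
  refine exists_congr fun ε => and_congr_right fun hε => ?_
  have hεε : conj ε * ε = 1 := by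
    rw [mul_comm, Complex.mul_conj, Complex.normSq_eq_norm_sq, hε]; simp
  constructor
  · intro h
    have h1 : EqOn (deriv f) (fun z => deriv k (ε * z)) (ball 0 1) := fun z hz => by
      have h2 : f =ᶠ[𝓝 z] fun y => conj ε * k (ε * y) := by
        filter_upwards [isOpen_ball.mem_nhds hz] with y hy using h y hy
      rw [h2.deriv_eq, ((hmul (hkd _ (mul_mem_ball hε hz))).const_mul (conj ε)).deriv]
      linear_combination (deriv k (ε * z)) * hεε
    have hkd2 : ∀ y ∈ ball (0 : ℂ) 1, HasDerivAt (deriv k) (deriv (deriv k) y) y := fun y hy =>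
      ((hk.holomorphic.deriv isOpen_ball).differentiableAt (isOpen_ball.mem_nhds hy)).hasDerivAt
    refine isOpen_ball.eqOn_of_deriv_eq hpre
      (fun z hz => (hf.hasDerivAt_logDer hz).differentiableAt.differentiableWithinAt)
      (fun z hz => (hmul (hk.hasDerivAt_logDer
        (mul_mem_ball hε hz))).differentiableAt.differentiableWithinAt) (fun z hz => ?_) h00
      (by simp [(logDer_spec hf).2.1, (logDer_spec hk).2.1])
    have h2 : deriv f =ᶠ[𝓝 z] fun y => deriv k (ε * y) := by
      filter_upwards [isOpen_ball.mem_nhds hz] with y hy using h1 hy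
    rw [(hf.hasDerivAt_logDer hz).deriv, (hmul (hk.hasDerivAt_logDer (mul_mem_ball hε hz))).deriv,
      h2.deriv_eq, h2.self_of_nhds, (hmul (hkd2 _ (mul_mem_ball hε hz))).deriv]
    ring
  · intro h
    refine isOpen_ball.eqOn_of_deriv_eq hpre hf.holomorphic
      (fun z hz => ((hmul (hkd _ (mul_mem_ball hε hz))).const_mul
        (conj ε)).differentiableAt.differentiableWithinAt) (fun z hz => ?_) h00
      (by simp [hf.map_zero, hk.map_zero])
    rw [((hmul (hkd _ (mul_mem_ball hε hz))).const_mul (conj ε)).deriv,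
      ← (logDer_spec hf).2.2 z hz, h z hz, (logDer_spec hk).2.2 _ (mul_mem_ball hε hz)]
    linear_combination -(deriv k (ε * z)) * hεε

/-- The logarithms of the derivatives of functions in `C(Ω)` are subordinate to that of the
extremal function, which vanishes only at the origin. -/
theorem exists_lift_logDer {Ω : Set ℂ} {φ f : ℂ → ℂ} (hΩ : IsOpen Ω)
    (hstar : StarConvex ℝ (1 : ℂ) Ω) (hφ : IsNormalizedConformalMap Ω φ) (hf : MemC Ω f) {R : ℝ}
    (hR0 : 0 < R) (hR : R < 1) :
    (∃ L : ℂ → ℂ, DifferentiableOn ℂ L (ball 0 1) ∧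
      ∀ z ∈ ball (0 : ℂ) 1, logDer (kFun φ) z = z * Complex.exp (L z)) ∧
    ∃ ω, IsDiskLift (logDer (kFun φ)) (logDer f) R ω ∧ ∀ z ∈ ball (0 : ℂ) R, ‖ω z‖ ≤ ‖z‖ := by
  have hk := hφ.memC_kFun
  have hm : MapsTo φ (ball 0 1) Ω := hφ.bijective.mapsTo
  obtain ⟨ψ, hψ, hψm, hr, hl⟩ := exists_holomorphic_inverse hΩ hφ.holomorphic hφ.bijective
  have hord : RadiallyOrdered φ := fun a ha b hb s hs0 hs1 hab =>
    norm_le_of_starConvex hstar hφ.holomorphic hm hφ.map_zero hψ hψm hl ha hb hs0 hs1 hab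
  have hKd := (logDer_spec hk).1
  have hKder : ∀ z ∈ ball (0 : ℂ) 1, deriv (logDer (kFun φ)) z = dslope φ 0 z := fun z hz => by
    rw [(hk.hasDerivAt_logDer hz).deriv, hφ.deriv_deriv_kFun hz]
  have hK' : ∀ z ∈ ball (0 : ℂ) 1, deriv (logDer (kFun φ)) z ≠ 0 := fun z hz => by
    rw [hKder z hz]
    exact hφ.dslope_ne_zero hz
  have hKφ : ∀ z ∈ ball (0 : ℂ) 1, z * deriv (logDer (kFun φ)) z = φ z - 1 := fun z hz => by
    rw [hKder z hz, hφ.mul_dslope]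
  have hK0 := (logDer_spec hk).2.1
  constructor
  · have hne := dslope_ne_zero_of_radiallyOrdered hstar hm hψm hr hord hKd hK' hKφ hK0
    obtain ⟨L, hL, hLe⟩ := exists_log_of_ne_zero
      ((Complex.differentiableOn_dslope (isOpen_ball.mem_nhds (by simp))).2 hKd) hne
    refine ⟨L, hL, fun z hz => ?_⟩
    rw [← hLe z hz]
    simpa [hK0] using (sub_smul_dslope (logDer (kFun φ)) 0 z).symm
  · refine exists_subordination hord hKd hK' hKφ (logDer_spec hf).1
      (by rw [hK0, (logDer_spec hf).2.1]) (fun z hz => ?_) hR0 hR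
    set p : ℂ → ℂ := fun z => 1 + z * deriv (deriv f) z / deriv f z with hp
    have hd := hf.holomorphic.deriv isOpen_ball
    have hpd : DifferentiableOn ℂ p (ball 0 1) :=
      ((differentiableOn_id.mul (hd.deriv isOpen_ball)).div hd hf.deriv_ne_zero).const_add 1
    -- The function `ψ ∘ p` maps the disk into itself and fixes `0`, so the Schwarz lemma bounds it
    -- by `|z|`.
    refine ⟨ψ (p z), ?_, ?_⟩
    · refine Complex.norm_le_norm_of_mapsTo_ball (f := fun z => ψ (p z)) (hψ.comp hpd hf.mem)
        (fun y hy => ball_subset_closedBall (hψm (hf.mem y hy))) ?_ (mem_ball_zero_iff.1 hz)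
      have := hl 0 (by simp)
      rw [hφ.map_zero] at this
      simp [hp, this]
    · rw [hr _ (hf.mem z hz), (hf.hasDerivAt_logDer hz).deriv]
      ring

end ConvexMeans

/-! ### The main theorem -/

theorem corollary3 (Ω : Set ℂ) (hΩ : IsOpen Ω) (h1 : (1 : ℂ) ∈ Ω) (hne : Ω ≠ Set.univ)
    (hstar : StarConvex ℝ (1 : ℂ) Ω)
    (φ : ℂ → ℂ) (hφ : ConvexMeans.IsNormalizedConformalMap Ω φ)
    (f : ℂ → ℂ) (hf : ConvexMeans.MemC Ω f) (r : ℝ) (hr0 : 0 < r) (hr1 : r < 1) :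
    -- the mean of `log |log f'|`
    (ConvexMeans.logLogMean f r ≤ ConvexMeans.logLogMean (ConvexMeans.kFun φ) r ∧
      (ConvexMeans.logLogMean f r = ConvexMeans.logLogMean (ConvexMeans.kFun φ) r ↔
        ConvexMeans.IsRotationOf (ConvexMeans.kFun φ) f)) ∧
    -- the means of `|log f'| ^ p`
    (∀ p : ℝ, 0 < p →
      (∫ θ in (-Real.pi)..Real.pi, ‖ConvexMeans.logDer f (circleMap 0 r θ)‖ ^ p) ≤
        (∫ θ in (-Real.pi)..Real.pi,
          ‖ConvexMeans.logDer (ConvexMeans.kFun φ) (circleMap 0 r θ)‖ ^ p) ∧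
      ((∫ θ in (-Real.pi)..Real.pi, ‖ConvexMeans.logDer f (circleMap 0 r θ)‖ ^ p) =
        (∫ θ in (-Real.pi)..Real.pi,
          ‖ConvexMeans.logDer (ConvexMeans.kFun φ) (circleMap 0 r θ)‖ ^ p) ↔
        ConvexMeans.IsRotationOf (ConvexMeans.kFun φ) f)) ∧
    -- the means of `Φ(± log |f'|)` and `Φ(± arg f')`, with the sign `s = ±1`
    (∀ Φ : ℝ → ℝ, Continuous Φ → ConvexOn ℝ Set.univ Φ → ∀ s : ℝ, s = 1 ∨ s = -1 →
      ((∫ θ in (-Real.pi)..Real.pi, Φ (s * Real.log ‖deriv f (circleMap 0 r θ)‖)) ≤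
          (∫ θ in (-Real.pi)..Real.pi,
            Φ (s * Real.log ‖deriv (ConvexMeans.kFun φ) (circleMap 0 r θ)‖)) ∧
        (¬ ConvexMeans.IsLinearOn (fun t => Φ (s * t))
            (ConvexMeans.circleRange
              (fun z => Real.log ‖deriv (ConvexMeans.kFun φ) z‖) r) →
          ((∫ θ in (-Real.pi)..Real.pi, Φ (s * Real.log ‖deriv f (circleMap 0 r θ)‖)) =
            (∫ θ in (-Real.pi)..Real.pi,
              Φ (s * Real.log ‖deriv (ConvexMeans.kFun φ) (circleMap 0 r θ)‖)) ↔
            ConvexMeans.IsRotationOf (ConvexMeans.kFun φ) f))) ∧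
      ((∫ θ in (-Real.pi)..Real.pi, Φ (s * ConvexMeans.argDer f (circleMap 0 r θ))) ≤
          (∫ θ in (-Real.pi)..Real.pi,
            Φ (s * ConvexMeans.argDer (ConvexMeans.kFun φ) (circleMap 0 r θ))) ∧
        (¬ ConvexMeans.IsLinearOn (fun t => Φ (s * t))
            (ConvexMeans.circleRange (ConvexMeans.argDer (ConvexMeans.kFun φ)) r) →
          ((∫ θ in (-Real.pi)..Real.pi, Φ (s * ConvexMeans.argDer f (circleMap 0 r θ))) =
            (∫ θ in (-Real.pi)..Real.pi,
              Φ (s * ConvexMeans.argDer (ConvexMeans.kFun φ) (circleMap 0 r θ))) ↔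
            ConvexMeans.IsRotationOf (ConvexMeans.kFun φ) f)))) := by
  obtain ⟨R, hrR, hR⟩ := exists_between hr1
  have hR0 : 0 < R := hr0.trans hrR
  have hk := hφ.memC_kFun
  obtain ⟨⟨L, hL, hKL⟩, ω, hω, hle⟩ := ConvexMeans.exists_lift_logDer hΩ hstar hφ hf hR0 hR
  have hcm : ∀ θ : ℝ, circleMap 0 r θ ∈ Metric.ball (0 : ℂ) 1 := fun θ => by
    simpa [abs_of_pos hr0] using hr1
  have hlog : ∀ {g : ℂ → ℂ}, ConvexMeans.MemC Ω g → ∀ θ : ℝ,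
      Real.log ‖deriv g (circleMap 0 r θ)‖ = (1 * ConvexMeans.logDer g (circleMap 0 r θ)).re :=
    fun hg θ => by
      rw [← (ConvexMeans.logDer_spec hg).2.2 _ (hcm θ), Complex.norm_exp, Real.log_exp, one_mul]
  -- Both `log |g'|` and `arg g'` are real parts of `c log g'`, with `c = 1` and `c = -i`, so one
  -- comparison covers both families of means.
  have harg : ∀ (g : ℂ → ℂ) (z : ℂ),
      ConvexMeans.argDer g z = (-Complex.I * ConvexMeans.logDer g z).re := fun g z => by
    simp [ConvexMeans.argDer]
  have hrange : ConvexMeans.circleRange (fun z => Real.log ‖deriv (ConvexMeans.kFun φ) z‖) r =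
      ConvexMeans.circleRange (fun z => (1 * ConvexMeans.logDer (ConvexMeans.kFun φ) z).re) r := by
    simp only [ConvexMeans.circleRange, hlog hk]
  simp only [hrange, hlog hf, hlog hk, harg, ConvexMeans.logLogMean,
    funext (harg (ConvexMeans.kFun φ))]
  have hiff := ConvexMeans.isRotationOf_iff hf hk
  by_cases hrot : ConvexMeans.IsRotationOf (ConvexMeans.kFun φ) f
  · obtain ⟨ε, hε, hFK⟩ := hiff.1 hrot
    simp only [hrot, iff_true, fun θ => hFK _ (hcm θ)]
    refine ⟨?_, fun p _ => ?_, fun Φ _ _ s _ => ⟨?_, ?_⟩⟩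
    · refine (fun h => ⟨h.le, h⟩) ?_
      have hne : ∀ z ∈ Metric.ball (0 : ℂ) 1, z ≠ 0 →
          ConvexMeans.logDer (ConvexMeans.kFun φ) z ≠ 0 := fun z hz hz0 => by
        rw [hKL z hz]
        exact mul_ne_zero hz0 (Complex.exp_ne_zero _)
      exact ConvexMeans.erealMean_log_rotate hr0 hr1
        (ConvexMeans.logDer_spec hk).1.continuousOn hne hε
    · refine (fun h => ⟨h.le, h⟩) ?_
      exact ConvexMeans.integral_circleMap_rotate
        (fun z => ‖ConvexMeans.logDer (ConvexMeans.kFun φ) z‖ ^ p) r hε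
    · refine (fun h => ⟨h.le, fun _ => h⟩) ?_
      exact ConvexMeans.integral_circleMap_rotate
        (fun z => Φ (s * (1 * ConvexMeans.logDer (ConvexMeans.kFun φ) z).re)) r hε
    · refine (fun h => ⟨h.le, fun _ => h⟩) ?_
      exact ConvexMeans.integral_circleMap_rotate
        (fun z => Φ (s * (-Complex.I * ConvexMeans.logDer (ConvexMeans.kFun φ) z).re)) r hε
  · have hlt : ∀ z ∈ Metric.ball (0 : ℂ) R, z ≠ 0 → ‖ω z‖ < ‖z‖ := by
      refine (ConvexMeans.eq_rotation_or_norm_lt hR0 hω.diff hle).resolve_left ?_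
      rintro ⟨ε, hε, hωε⟩
      refine hrot (hiff.2 ⟨ε, hε, ?_⟩)
      have hKε : DifferentiableOn ℂ
          (fun z => ConvexMeans.logDer (ConvexMeans.kFun φ) (ε * z)) (Metric.ball 0 1) :=
        (ConvexMeans.logDer_spec hk).1.comp (by fun_prop) fun z hz =>
          ConvexMeans.mul_mem_ball hε hz
      -- If `ω` were a rotation, `log f'` would agree with the rotated `log k'` on the disk of
      -- radius `R`, hence by the identity theorem on the whole unit disk, contradicting `hrot`.
      refine ((ConvexMeans.logDer_spec hf).1.analyticOnNhd
        Metric.isOpen_ball).eqOn_of_preconnected_of_eventuallyEq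
        (hKε.analyticOnNhd Metric.isOpen_ball) (convex_ball 0 1).isPreconnected
        (Metric.mem_ball_self one_pos) ?_
      filter_upwards [Metric.isOpen_ball.mem_nhds (Metric.mem_ball_self hR0)] with z hz
      rw [← hω.lift z hz, hωε z hz]
    have hm : Set.MapsTo ω (Metric.closedBall 0 r) (Metric.ball 0 r) := fun z hz => by
      rw [mem_closedBall_zero_iff] at hz
      rw [mem_ball_zero_iff]
      by_cases hz0 : z = 0
      · simpa [hz0, hω.map_zero] using hr0
      · exact (hlt z (mem_ball_zero_iff.2 (hz.trans_lt hrR)) hz0).trans_le hz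
    have hKd := (ConvexMeans.logDer_spec hk).1
    -- The sign is absorbed into the convex function `t ↦ Φ (s t)`.
    have hconv : ∀ (Φ : ℝ → ℝ), Continuous Φ → ConvexOn ℝ Set.univ Φ → ∀ s : ℝ,
        Continuous (fun t => Φ (s * t)) ∧ ConvexOn ℝ Set.univ (fun t => Φ (s * t)) :=
      fun Φ hΦc hΦ s => ⟨by fun_prop, hΦ.comp_linearMap (LinearMap.mul ℝ ℝ s)⟩
    simp only [hrot, iff_false]
    refine ⟨?_, fun p hp => ?_, fun Φ hΦc hΦ s _ => ⟨?_, ?_⟩⟩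
    · exact (fun h => ⟨h.le, h.ne⟩) (ConvexMeans.erealMean_log_lt hr0 hrR hR hL hKL hω hm)
    · exact (fun h => ⟨h.le, h.ne⟩) (ConvexMeans.integral_norm_rpow_lt hr0 hrR hR hp hKd hL hKL hω hm)
    · have h := ConvexMeans.integral_convex_re_le (c := 1) (hconv Φ hΦc hΦ s).1 (hconv Φ hΦc hΦ s).2
        hr0 hrR hR hKd hω hm
      exact ⟨h.1, fun hlin => (h.2 hlin).ne⟩
    · have h := ConvexMeans.integral_convex_re_le (c := -Complex.I) (hconv Φ hΦc hΦ s).1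
        (hconv Φ hΦc hΦ s).2 hr0 hrR hR hKd hω hm
      exact ⟨h.1, fun hlin => (h.2 hlin).ne⟩
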